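/- Let $0<d<\pi/2$, let $\mathscr{D}_d=\{\zeta\in\mathbb{C}:|\operatorname{Im}\zeta|<d\}$, and let $\psi(\zeta)=\exp\!\left(\frac{\pi}{2}\sinh\zeta\right)$, so that $\psi$ maps $\mathbb{R}$ bijectively onto $(0,\infty)$, with inverse $\psi^{-1}(\tau)=\operatorname{arcsinh}\!\left(\frac{2}{\pi}\log\tau\right)$. Assume that $f$ is analytic in the image $\psi(\mathscr{D}_d)\subset\mathbb{C}$ and that $K,\alpha,\beta>0$ are constants such that $$|f(z)|\le K\left|\frac{z^{\alpha-1}}{(1+z^2)^{(\alpha+\beta)/2}}\right|\qquad\text{for all } z\in\psi(\mathscr{D}_d).$$ Let $\mu=\min\{\alpha,\beta\}$, $\nu=\max\{\alpha,\beta\}$, let $n$ be a nonnegative integer, let $h=\log(4dn/\mu)/n$, and let $$\begin{cases} M=n,\quad N=n-\lfloor\log(\beta/\alpha)/h\rfloor & (\text{if }\mu=\alpha),\\ N=n,\quad M=n-\lfloor\log(\alpha/\beta)/h\rfloor & (\text{if }\mu=\beta).\end{cases}$$ For $\gamma>0$ put $$x_\gamma=\begin{cases}\operatorname{arcsinh}\!\left(\dfrac{\sqrt{1+\sqrt{1-(2\pi\gamma)^2}}}{2\pi\gamma}\right)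 & (0<\gamma<1/(2\pi)),\\[2mm] \operatorname{arcsinh}(1) & (\gamma\ge 1/(2\pi)),\end{cases}$$ and assume that $n$ is so large that $n\ge \nu\mathrm{e}/(4d)$, $Mh\ge x_{\alpha/2}$ and $Nh\ge x_{\beta/2}$. Let $$J(k,h)(x)=h\left\{\frac12+\frac1\pi\operatorname{Si}\!\left[\pi\left(\frac{x}{h}-k\right)\right]\right\},\qquad \operatorname{Si}(x)=\int_0^x\frac{\sin\sigma}{\sigma}\,d\sigma .$$ Then $f$ is integrable on $(0,\tau)$ for every $\tau>0$, and $$\sup_{\tau\in(0,\infty)}\left|\int_0^\tau f(t)\,dt-\sum_{k=-M}^{N}f(\psi(kh))\,\psi'(kh)\,J(k,h)(\psi^{-1}(\tau))\right|\le C_2\,\varepsilon^{\mathrm{DE}}_{d,\mu}(n),$$ where $$\varepsilon^{\mathrm{DE}}_{d,\mu}(n)=\mathrm{e}^{-\pi dn/\log(4dn/\mu)}\,\frac{\log(4dn/\mu)}{n}$$ and $$C_2=\frac{2K}{\mu d}\left\{\frac{1}{(1-\mathrm{e}^{-\pi\mu\mathrm{e}/2})\{\cos(\frac{\pi}{2}\sin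 d)\}^{(\alpha+\beta)/2}\cos d}+\mathrm{e}^{\pi(\alpha+\beta)/4}\right\},$$ which does not depend on $n$. -/

import Mathlib

namespace SincDE

/-- The strip `{ζ : |Im ζ| < d}`. -/
def strip (d : ℝ) : Set ℂ := {ζ : ℂ | |ζ.im| < d}

/-- The double-exponential map `ψ(ζ) = exp((π/2) sinh ζ)`. -/
noncomputable def deMap (ζ : ℂ) : ℂ :=
  Complex.exp ((Real.pi : ℂ) / 2 * Complex.sinh ζ)

/-- The inverse `(0, ∞) → ℝ` of the restriction of `deMap` to the real line. -/
noncomputable def deInv (τ : ℝ) : ℝ := Real.arsinh (2 / Real.pi * Real.log τ)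

theorem deMap_deInv {τ : ℝ} (hτ : 0 < τ) : deMap (deInv τ : ℂ) = (τ : ℂ) := by
  have h : Real.pi / 2 * (2 / Real.pi * Real.log τ) = Real.log τ := by
    field_simp
  have : deMap (deInv τ : ℂ) = ((Real.exp (Real.pi / 2 * Real.sinh (deInv τ)) : ℝ) : ℂ) := by
    simp [deMap]
  rw [this, deInv, Real.sinh_arsinh, h, Real.exp_log hτ]

theorem deInv_deMap (x : ℝ) : deInv (deMap (x : ℂ)).re = x := by
  have : deMap (x : ℂ) = ((Real.exp (Real.pi / 2 * Real.sinh x) : ℝ) : ℂ) := by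
    simp [deMap]
  have h : 2 / Real.pi * (Real.pi / 2 * Real.sinh x) = Real.sinh x := by
    field_simp
  rw [this, Complex.ofReal_re, deInv, Real.log_exp, h, Real.arsinh_sinh]

/-- `E₂(z; α, β) = z^(α-1) / (1+z²)^((α+β)/2)` (only its modulus is used, which does not depend
on the branch of the powers, the exponents being real). -/
noncomputable def E₂ (z : ℂ) (α β : ℝ) : ℂ :=
  z ^ ((α - 1 : ℝ) : ℂ) / (1 + z ^ 2) ^ (((α + β) / 2 : ℝ) : ℂ)

/-- The sine integral `Si(x) = ∫₀ˣ sin σ / σ dσ`. -/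
noncomputable def Si (x : ℝ) : ℝ := ∫ σ in (0 : ℝ)..x, Real.sinc σ

/-- The basis function of the Sinc indefinite integration,
`J(k,h)(x) = h {1/2 + (1/π) Si[π(x/h - k)]}`. -/
noncomputable def J (k : ℤ) (h x : ℝ) : ℝ :=
  h * (1 / 2 + 1 / Real.pi * Si (Real.pi * (x / h - k)))

/-- The threshold `x_γ`, for `γ > 0`. -/
noncomputable def xThreshold (γ : ℝ) : ℝ :=
  if γ < 1 / (2 * Real.pi) then
    Real.arsinh (Real.sqrt (1 + Real.sqrt (1 - (2 * Real.pi * γ) ^ 2)) / (2 * Real.pi * γ))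
  else Real.arsinh 1

/-- The lower truncation number: `n` if `α ≤ β`, and `n - ⌊log(α/β)/h⌋` otherwise. -/
noncomputable def truncM (α β h : ℝ) (n : ℕ) : ℤ :=
  if α ≤ β then n else n - ⌊Real.log (α / β) / h⌋

/-- The upper truncation number: `n - ⌊log(β/α)/h⌋` if `α ≤ β`, and `n` otherwise. -/
noncomputable def truncN (α β h : ℝ) (n : ℕ) : ℤ :=
  if α ≤ β then n - ⌊Real.log (β / α) / h⌋ else n

/-- `ε_{d,μ}(n) = exp(-π d n / log(4 d n / μ)) · log(4 d n / μ) / n`. -/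
noncomputable def epsDE (d μ : ℝ) (n : ℕ) : ℝ :=
  Real.exp (-(Real.pi * d * n / Real.log (4 * d * n / μ))) * Real.log (4 * d * n / μ) / n

/-- The explicit constant of the error bound. -/
noncomputable def constC₂ (K α β d μ : ℝ) : ℝ :=
  2 * K / (μ * d) *
    (1 / ((1 - Real.exp (-(Real.pi * μ * Real.exp 1 / 2))) *
          Real.cos (Real.pi / 2 * Real.sin d) ^ ((α + β) / 2) * Real.cos d)
      + Real.exp (Real.pi * (α + β) / 4))

end SincDE

/-! Substituting `t = ψ(ζ)` turns the integral over `(0, τ)` into the integral of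
`F(ζ) = ψ'(ζ) f(ψ(ζ))` over `(-∞, ψ⁻¹(τ))`, where `F` is analytic in the strip and decays double
exponentially. For real `u`, the error of Sinc interpolation of `F` at `u` is, by residues, a
contour integral over a large rectangle with kernel `sin(πu/h) / (sin(πz/h) (z - u))`. Integrating
in `u` over `[s, t]` replaces `sin(πu/h) / (z - u)` by the Cauchy transform of the sine, which one
integration by parts bounds by `h / |Im z|`: the oscillation gains the factor `h`. Letting the
rectangle grow and `s → -∞` leaves the discretization error `O(h e^{-πd/h})`. The tails of the sum
are compared with the telescoping increments of `exp (-q sinh x)`, and the choice of `h`, `M` and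
`N` makes both errors `O(ε)`.
-/

namespace SincDE

open MeasureTheory Filter Topology
open scoped Real
open Complex (I)

/-! ### The sine integral -/

theorem intervalIntegral_swap_of_continuousOn {E : Type*} [NormedAddCommGroup E] [NormedSpace ℝ E]
    {f : ℝ → ℝ → E} {a b c d : ℝ}
    (hf : ContinuousOn (Function.uncurry f) (Set.uIcc a b ×ˢ Set.uIcc c d)) :
    ∫ x in a..b, ∫ y in c..d, f x y = ∫ y in c..d, ∫ x in a..b, f x y :=
  intervalIntegral_intervalIntegral_swap <|
    (hf.integrableOn_compact (isCompact_uIcc.prod isCompact_uIcc)).mono_set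
      (Set.prod_mono Set.uIoc_subset_uIcc Set.uIoc_subset_uIcc)

theorem integral_exp_neg_mul {r : ℝ} (hr : r ≠ 0) (T : ℝ) :
    ∫ t in (0 : ℝ)..T, Real.exp (-(r * t)) = (1 - Real.exp (-(r * T))) / r := by
  have := intervalIntegral.integral_comp_mul_left (a := 0) (b := T) Real.exp (neg_ne_zero.2 hr)
  simp only [neg_mul, mul_zero, integral_exp, Real.exp_zero, smul_eq_mul] at this
  rw [this]
  field_simp
  ring

theorem integral_exp_neg_mul_le {r : ℝ} (hr : 0 < r) (T : ℝ) :
    ∫ t in (0 : ℝ)..T, Real.exp (-(r * t)) ≤ 1 / r := by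
  rw [integral_exp_neg_mul hr.ne']
  gcongr
  linarith [Real.exp_pos (-(r * T))]

theorem integral_sin_mul_exp_left (x T : ℝ) :
    ∫ t in (0 : ℝ)..T, Real.sin x * Real.exp (-(x * t)) =
      Real.sinc x * (1 - Real.exp (-(x * T))) := by
  rcases eq_or_ne x 0 with rfl | hx
  · simp
  · rw [intervalIntegral.integral_const_mul, integral_exp_neg_mul hx, Real.sinc_of_ne_zero hx]
    ring

theorem integral_sin_mul_exp_right (t R : ℝ) :
    ∫ x in (0 : ℝ)..R, Real.sin x * Real.exp (-(x * t)) =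
      (1 + t ^ 2)⁻¹ - Real.exp (-(R * t)) * (Real.cos R + t * Real.sin R) / (1 + t ^ 2) := by
  have hpos : 1 + t ^ 2 ≠ 0 := by positivity
  have hd : ∀ x ∈ Set.uIcc 0 R, HasDerivAt
      (fun x ↦ -(Real.exp (-(x * t)) * (Real.cos x + t * Real.sin x)) / (1 + t ^ 2))
      (Real.sin x * Real.exp (-(x * t))) x := by
    intro x _
    have hneg_mul : HasDerivAt (fun x : ℝ ↦ -(x * t)) (-t) x := by
      convert! ((hasDerivAt_id x).mul_const t).neg using 1
      simp
    convert! (hneg_mul.exp.mul ((Real.hasDerivAt_cos x).add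
      ((Real.hasDerivAt_sin x).const_mul t))).neg.div_const (1 + t ^ 2) using 1
    field_simp
    simp only [Pi.add_apply]
    ring
  rw [intervalIntegral.integral_eq_sub_of_hasDerivAt hd
      (by apply Continuous.intervalIntegrable; fun_prop)]
  simp only [zero_mul, neg_zero, Real.exp_zero, Real.cos_zero, Real.sin_zero, mul_zero]
  ring

theorem continuous_exp_mul_div_one_add_sq (R : ℝ) : Continuous fun t : ℝ ↦
    Real.exp (-(R * t)) * (Real.cos R + t * Real.sin R) / (1 + t ^ 2) :=
  Continuous.div (by fun_prop) (by fun_prop) fun t ↦ by positivity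

-- Integrate `sin x * exp (-x t)` over `[0, R] × [0, T]` in the two possible orders.
theorem Si_sub_arctan_eq (R T : ℝ) :
    Si R - Real.arctan T = (∫ x in (0 : ℝ)..R, Real.sinc x * Real.exp (-(x * T))) -
      ∫ t in (0 : ℝ)..T, Real.exp (-(R * t)) * (Real.cos R + t * Real.sin R) / (1 + t ^ 2) := by
  have hswap : ∫ x in (0 : ℝ)..R, Real.sinc x * (1 - Real.exp (-(x * T))) =
      ∫ t in (0 : ℝ)..T, ((1 + t ^ 2)⁻¹ -
        Real.exp (-(R * t)) * (Real.cos R + t * Real.sin R) / (1 + t ^ 2)) := by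
    simp_rw [← integral_sin_mul_exp_left, ← integral_sin_mul_exp_right]
    refine intervalIntegral_swap_of_continuousOn (Continuous.continuousOn ?_)
    unfold Function.uncurry
    fun_prop
  have hinv : Continuous fun t : ℝ ↦ (1 + t ^ 2)⁻¹ :=
    Continuous.inv₀ (by fun_prop) fun t ↦ by positivity
  have hleft : ∫ x in (0 : ℝ)..R, Real.sinc x * (1 - Real.exp (-(x * T))) =
      Si R - ∫ x in (0 : ℝ)..R, Real.sinc x * Real.exp (-(x * T)) := by
    simp_rw [mul_one_sub]
    exact intervalIntegral.integral_sub (by apply Continuous.intervalIntegrable; fun_prop)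
      (by apply Continuous.intervalIntegrable; fun_prop)
  rw [intervalIntegral.integral_sub (hinv.intervalIntegrable _ _)
    ((continuous_exp_mul_div_one_add_sq R).intervalIntegrable _ _),
    integral_inv_one_add_sq, Real.arctan_zero, sub_zero, hleft] at hswap
  linarith

theorem abs_integral_sinc_mul_exp_le {R T : ℝ} (hR : 0 ≤ R) (hT : 0 < T) :
    |∫ x in (0 : ℝ)..R, Real.sinc x * Real.exp (-(x * T))| ≤ 1 / T := by
  refine le_trans ?_ (integral_exp_neg_mul_le hT R)
  rw [← Real.norm_eq_abs]
  refine intervalIntegral.norm_integral_le_of_norm_le hR (Eventually.of_forall fun x _ ↦ ?_)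
    (by apply Continuous.intervalIntegrable; fun_prop)
  rw [norm_mul, Real.norm_eq_abs, Real.norm_eq_abs, Real.abs_exp, mul_comm T]
  exact mul_le_of_le_one_left (Real.exp_pos _).le (Real.abs_sinc_le_one x)

theorem abs_cos_add_mul_sin_le (R t : ℝ) : |Real.cos R + t * Real.sin R| ≤ 1 + t ^ 2 := by
  refine abs_le_of_sq_le_sq ?_ (by positivity)
  nlinarith [Real.sin_sq_add_cos_sq R, sq_nonneg (t * Real.cos R - Real.sin R), sq_nonneg t]

theorem abs_integral_exp_mul_div_one_add_sq_le {R T : ℝ} (hR : 0 < R) (hT : 0 ≤ T) :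
    |∫ t in (0 : ℝ)..T, Real.exp (-(R * t)) * (Real.cos R + t * Real.sin R) / (1 + t ^ 2)| ≤
      1 / R := by
  refine le_trans ?_ (integral_exp_neg_mul_le hR T)
  rw [← Real.norm_eq_abs]
  refine intervalIntegral.norm_integral_le_of_norm_le hT (Eventually.of_forall fun t _ ↦ ?_)
    (by apply Continuous.intervalIntegrable; fun_prop)
  have hpos : 0 < 1 + t ^ 2 := by positivity
  rw [norm_div, norm_mul, Real.norm_eq_abs, Real.norm_eq_abs, Real.norm_eq_abs, Real.abs_exp,
    abs_of_pos hpos, div_le_iff₀ hpos]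
  exact mul_le_mul_of_nonneg_left (abs_cos_add_mul_sin_le R t) (Real.exp_pos _).le

theorem abs_Si_sub_arctan_le {R T : ℝ} (hR : 0 < R) (hT : 0 < T) :
    |Si R - Real.arctan T| ≤ 1 / T + 1 / R := by
  rw [Si_sub_arctan_eq]
  exact (abs_sub _ _).trans (add_le_add (abs_integral_sinc_mul_exp_le hR.le hT)
    (abs_integral_exp_mul_div_one_add_sq_le hR hT.le))

theorem abs_Si_sub_pi_div_two_le {R : ℝ} (hR : 0 < R) : |Si R - π / 2| ≤ 1 / R := by
  have hleft : Tendsto (fun T : ℝ ↦ |Si R - Real.arctan T|) atTop (𝓝 |Si R - π / 2|) :=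
    ((Real.tendsto_arctan_atTop.mono_right nhdsWithin_le_nhds).const_sub (Si R)).abs
  have hright : Tendsto (fun T : ℝ ↦ 1 / T + 1 / R) atTop (𝓝 (1 / R)) := by
    simpa only [zero_add, id] using (tendsto_const_nhds.div_atTop tendsto_id).add_const (1 / R)
  exact le_of_tendsto_of_tendsto hleft hright
    ((eventually_gt_atTop 0).mono fun T hT ↦ abs_Si_sub_arctan_le hR hT)

theorem Si_neg (x : ℝ) : Si (-x) = -Si x := by
  have := intervalIntegral.integral_comp_neg (a := 0) (b := x) Real.sinc
  simp only [Real.sinc_neg, neg_zero] at this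
  rw [Si, Si, intervalIntegral.integral_symm, this]

theorem abs_Si_le (x : ℝ) : |Si x| ≤ 3 := by
  wlog hx : 0 ≤ x generalizing x
  · have := this (-x) (by linarith)
    rwa [Si_neg, abs_neg] at this
  rcases le_total x 1 with hx1 | hx1
  · have := intervalIntegral.norm_integral_le_of_norm_le_const (a := 0) (b := x) (C := 1)
      (f := Real.sinc) fun σ _ ↦ Real.abs_sinc_le_one σ
    rw [sub_zero, abs_of_nonneg hx, Real.norm_eq_abs] at this
    rw [Si]
    linarith
  · have hlim := abs_le.1 (abs_Si_sub_pi_div_two_le (R := x) (by linarith))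
    have hinv : 1 / x ≤ 1 := (div_le_one (by linarith)).2 hx1
    rw [abs_le]
    constructor <;> linarith [Real.pi_pos, Real.pi_le_four, hlim.1, hlim.2]

theorem tendsto_Si_atTop : Tendsto Si atTop (𝓝 (π / 2)) := by
  rw [tendsto_iff_norm_sub_tendsto_zero]
  exact squeeze_zero' (Eventually.of_forall fun _ ↦ norm_nonneg _)
    ((eventually_gt_atTop 0).mono fun R hR ↦ abs_Si_sub_pi_div_two_le hR)
    (tendsto_const_nhds.div_atTop tendsto_id)

theorem tendsto_Si_atBot : Tendsto Si atBot (𝓝 (-(π / 2))) :=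
  (tendsto_Si_atTop.comp tendsto_neg_atBot_atTop).neg.congr fun x ↦ by simp [Si_neg]

theorem hasDerivAt_Si (x : ℝ) : HasDerivAt Si (Real.sinc x) x :=
  intervalIntegral.integral_hasDerivAt_right (Real.continuous_sinc.intervalIntegrable _ _)
    (Real.continuous_sinc.stronglyMeasurableAtFilter _ _) Real.continuous_sinc.continuousAt

theorem abs_J_le (k : ℤ) {h : ℝ} (hh : 0 ≤ h) (x : ℝ) : |J k h x| ≤ 3 / 2 * h := by
  rw [J, abs_mul, abs_of_nonneg hh, mul_comm]
  refine mul_le_mul_of_nonneg_right ?_ hh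
  have hSi : |1 / π * Si (π * (x / h - k))| ≤ 1 := by
    rw [abs_mul, abs_of_pos (by positivity), one_div, inv_mul_le_one₀ Real.pi_pos]
    exact (abs_Si_le _).trans Real.pi_gt_three.le
  rw [abs_le] at hSi ⊢
  constructor <;> linarith [hSi.1, hSi.2]

theorem tendsto_J_atBot (k : ℤ) {h : ℝ} (hh : 0 < h) : Tendsto (J k h) atBot (𝓝 0) := by
  have harg : Tendsto (fun x : ℝ ↦ π * (x / h - k)) atBot atBot :=
    (tendsto_atBot_add_const_right _ _ (tendsto_id.atBot_div_const hh)).const_mul_atBot Real.pi_pos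
  convert! (((tendsto_Si_atBot.comp harg).const_mul (1 / π)).const_add (1 / 2)).const_mul h using 2
  field_simp
  ring

theorem hasDerivAt_J (k : ℤ) {h : ℝ} (hh : h ≠ 0) (x : ℝ) :
    HasDerivAt (J k h) (Real.sinc (π * (x / h - k))) x := by
  have harg : HasDerivAt (fun x : ℝ ↦ π * (x / h - k)) (π * (1 / h)) x :=
    (((hasDerivAt_id x).div_const h).sub_const _).const_mul _
  convert! ((((hasDerivAt_Si _).comp x harg).const_mul (1 / π)).const_add (1 / 2)).const_mul h
    using 1
  field_simp

theorem integral_sinc_eq_J_sub (k : ℤ) {h : ℝ} (hh : h ≠ 0) (A X : ℝ) :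
    ∫ s in A..X, Real.sinc (π * (s / h - k)) = J k h X - J k h A :=
  intervalIntegral.integral_eq_sub_of_hasDerivAt (fun x _ ↦ hasDerivAt_J k hh x)
    (by apply Continuous.intervalIntegrable; fun_prop)

/-! ### Contour integrals over rectangles -/

section Rectangle

variable {E : Type*} [NormedAddCommGroup E] [NormedSpace ℂ E] {a b c d : ℝ}

/-- The integral of `g` along the boundary of the rectangle `[a, b] × [c, d]`, counterclockwise;
the residue theorem is used for this contour. -/
noncomputable def rectIntegral (g : ℂ → E) (a b c d : ℝ) : E :=
  (∫ x : ℝ in a..b, g (x + c * I)) - (∫ x : ℝ in a..b, g (x + d * I)) +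
    I • (∫ y : ℝ in c..d, g (b + y * I)) - I • (∫ y : ℝ in c..d, g (a + y * I))

/-- The boundary of the rectangle `[a, b] × [c, d]`, the contour of `rectIntegral`. -/
def rectBoundary (a b c d : ℝ) : Set ℂ :=
  {z | z.re ∈ Set.Icc a b ∧ z.im ∈ Set.Icc c d ∧ (z.re = a ∨ z.re = b ∨ z.im = c ∨ z.im = d)}

theorem horizontal_mem_rectBoundary (hcd : c ≤ d) {x y : ℝ} (hx : x ∈ Set.Icc a b)
    (hy : y = c ∨ y = d) : (x + y * I : ℂ) ∈ rectBoundary a b c d := by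
  rcases hy with rfl | rfl <;> simp [rectBoundary, hcd, hx.1, hx.2]

theorem vertical_mem_rectBoundary (hab : a ≤ b) {x y : ℝ} (hx : x = a ∨ x = b)
    (hy : y ∈ Set.Icc c d) : (x + y * I : ℂ) ∈ rectBoundary a b c d := by
  rcases hx with rfl | rfl <;> simp [rectBoundary, hab, hy.1, hy.2]

theorem rectBoundary_subset : rectBoundary a b c d ⊆ Set.Icc a b ×ℂ Set.Icc c d :=
  fun _ hz ↦ ⟨hz.1, hz.2.1⟩

theorem notMem_rectBoundary {p : ℂ} (hp : p ∈ Set.Ioo a b ×ℂ Set.Ioo c d) :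
    p ∉ rectBoundary a b c d := by
  obtain ⟨⟨h1, h2⟩, h3, h4⟩ := hp
  rintro ⟨-, -, h | h | h | h⟩ <;> linarith

theorem intervalIntegrable_horizontal {F : Type*} [NormedAddCommGroup F] (hab : a ≤ b)
    (hcd : c ≤ d) {g : ℂ → F} (hg : ContinuousOn g (rectBoundary a b c d))
    {y : ℝ} (hy : y = c ∨ y = d) :
    IntervalIntegrable (fun x : ℝ ↦ g (x + y * I)) volume a b :=
  ContinuousOn.intervalIntegrable_of_Icc hab <|
    hg.comp (by fun_prop) fun _ hx ↦ horizontal_mem_rectBoundary hcd hx hy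

theorem intervalIntegrable_vertical {F : Type*} [NormedAddCommGroup F] (hab : a ≤ b)
    (hcd : c ≤ d) {g : ℂ → F} (hg : ContinuousOn g (rectBoundary a b c d))
    {x : ℝ} (hx : x = a ∨ x = b) :
    IntervalIntegrable (fun y : ℝ ↦ g (x + y * I)) volume c d :=
  ContinuousOn.intervalIntegrable_of_Icc hcd <|
    hg.comp (by fun_prop) fun _ hy ↦ vertical_mem_rectBoundary hab hx hy

theorem rectIntegral_congr (hab : a ≤ b) (hcd : c ≤ d) {g₁ g₂ : ℂ → E}
    (hg : Set.EqOn g₁ g₂ (rectBoundary a b c d)) :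
    rectIntegral g₁ a b c d = rectIntegral g₂ a b c d := by
  have horizontal {y : ℝ} (hy : y = c ∨ y = d) :
      ∫ x : ℝ in a..b, g₁ (x + y * I) = ∫ x : ℝ in a..b, g₂ (x + y * I) :=
    intervalIntegral.integral_congr fun x hx ↦
      hg (horizontal_mem_rectBoundary hcd (Set.uIcc_of_le hab ▸ hx) hy)
  have vertical {x : ℝ} (hx : x = a ∨ x = b) :
      ∫ y : ℝ in c..d, g₁ (x + y * I) = ∫ y : ℝ in c..d, g₂ (x + y * I) :=
    intervalIntegral.integral_congr fun y hy ↦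
      hg (vertical_mem_rectBoundary hab hx (Set.uIcc_of_le hcd ▸ hy))
  rw [rectIntegral, rectIntegral, horizontal (.inl rfl), horizontal (.inr rfl),
    vertical (.inl rfl), vertical (.inr rfl)]

theorem rectIntegral_add (hab : a ≤ b) (hcd : c ≤ d) {g₁ g₂ : ℂ → E}
    (h₁ : ContinuousOn g₁ (rectBoundary a b c d)) (h₂ : ContinuousOn g₂ (rectBoundary a b c d)) :
    rectIntegral (fun z ↦ g₁ z + g₂ z) a b c d =
      rectIntegral g₁ a b c d + rectIntegral g₂ a b c d := by
  have horizontal {y : ℝ} (hy : y = c ∨ y = d) :=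
    intervalIntegral.integral_add (intervalIntegrable_horizontal hab hcd h₁ hy)
      (intervalIntegrable_horizontal hab hcd h₂ hy)
  have vertical {x : ℝ} (hx : x = a ∨ x = b) :=
    intervalIntegral.integral_add (intervalIntegrable_vertical hab hcd h₁ hx)
      (intervalIntegrable_vertical hab hcd h₂ hx)
  rw [rectIntegral, rectIntegral, rectIntegral, horizontal (.inl rfl), horizontal (.inr rfl),
    vertical (.inl rfl), vertical (.inr rfl)]
  module

theorem rectIntegral_smul_const [CompleteSpace E] (g : ℂ → ℂ) (v : E) :
    rectIntegral (fun z ↦ g z • v) a b c d = rectIntegral g a b c d • v := by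
  simp only [rectIntegral, intervalIntegral.integral_smul_const]
  module

theorem rectIntegral_const_smul (w : ℂ) (g : ℂ → E) :
    rectIntegral (fun z ↦ w • g z) a b c d = w • rectIntegral g a b c d := by
  simp only [rectIntegral, intervalIntegral.integral_smul]
  module

theorem rectIntegral_eq_zero [CompleteSpace E] (hab : a ≤ b) (hcd : c ≤ d) {g : ℂ → E}
    (hg : DifferentiableOn ℂ g (Set.Icc a b ×ℂ Set.Icc c d)) : rectIntegral g a b c d = 0 := by
  have := Complex.integral_boundary_rect_eq_zero_of_differentiableOn g ⟨a, c⟩ ⟨b, d⟩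
    (by rwa [Set.uIcc_of_le hab, Set.uIcc_of_le hcd])
  simpa [rectIntegral] using this

theorem integral_inv_eq_log_sub_log {γ : ℝ → ℂ} {γ' : ℂ} {s t : ℝ} (hst : s ≤ t)
    (hγ : ∀ u, HasDerivAt γ γ' u) (hslit : ∀ u ∈ Set.Icc s t, γ u ∈ Complex.slitPlane) :
    γ' * ∫ u in s..t, (γ u)⁻¹ = Complex.log (γ t) - Complex.log (γ s) := by
  rw [← Set.uIcc_of_le hst] at hslit
  rw [← intervalIntegral.integral_const_mul,
    intervalIntegral.integral_eq_sub_of_hasDerivAt (f := fun u ↦ Complex.log (γ u))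
      fun u hu ↦ by simpa only [div_eq_mul_inv] using (hγ u).clog_real (hslit u hu)]
  exact (continuousOn_const.mul (ContinuousOn.inv₀
    (fun u _ ↦ (hγ u).continuousAt.continuousWithinAt)
    fun u hu ↦ Complex.slitPlane_ne_zero (hslit u hu))).intervalIntegrable

theorem log_neg_of_im_pos {z : ℂ} (hz : 0 < z.im) : Complex.log (-z) = Complex.log z - π * I := by
  rw [Complex.log, Complex.log, norm_neg, Complex.arg_neg_eq_arg_sub_pi_of_im_pos hz]
  push_cast
  ring

theorem log_neg_of_im_neg {z : ℂ} (hz : z.im < 0) : Complex.log (-z) = Complex.log z + π * I := by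
  rw [Complex.log, Complex.log, norm_neg, Complex.arg_neg_eq_arg_add_pi_of_im_neg hz]
  push_cast
  ring

-- Three sides avoid the branch cut of the logarithm; on the left side `z - p` is replaced by its
-- negative, which produces the jump `2 * π * I`.
theorem rectIntegral_inv_sub {p : ℂ} (hp : p ∈ Set.Ioo a b ×ℂ Set.Ioo c d) :
    rectIntegral (fun z ↦ (z - p)⁻¹) a b c d = 2 * π * I := by
  obtain ⟨⟨ha, hb⟩, hc, hd⟩ := hp
  have horizontal (y u : ℝ) : HasDerivAt (fun x : ℝ ↦ (x + y * I - p : ℂ)) 1 u :=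
    (Complex.ofRealCLM.hasDerivAt.add_const _).sub_const _
  have vertical (x u : ℝ) : HasDerivAt (fun y : ℝ ↦ (x + y * I - p : ℂ)) I u := by
    simpa using ((Complex.ofRealCLM.hasDerivAt.mul_const I).const_add (x : ℂ)).sub_const p
  have bottom := integral_inv_eq_log_sub_log (ha.trans hb).le (horizontal c)
    fun u _ ↦ Or.inr (by simp; linarith)
  have top := integral_inv_eq_log_sub_log (ha.trans hb).le (horizontal d)
    fun u _ ↦ Or.inr (by simp; linarith)
  have right := integral_inv_eq_log_sub_log (hc.trans hd).le (vertical b)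
    fun u _ ↦ Or.inl (by simpa using hb)
  have left := integral_inv_eq_log_sub_log (hc.trans hd).le (fun u ↦ (vertical a u).neg)
    fun u _ ↦ Or.inl (by simpa using ha)
  simp_rw [Pi.neg_apply, inv_neg, intervalIntegral.integral_neg, neg_mul_neg] at left
  rw [log_neg_of_im_pos (by simpa using hd), log_neg_of_im_neg (by simpa using hc)] at left
  rw [one_mul] at bottom top
  rw [rectIntegral, smul_eq_mul, smul_eq_mul, bottom, top, right, left]
  ring

theorem exists_differentiableOn_sub_simple_pole [CompleteSpace E] {U : Set ℂ} (hU : IsOpen U)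
    {p : ℂ} (hp : p ∈ U) {g : ℂ → E} (hg : DifferentiableOn ℂ g (U \ {p})) {r : E}
    (hr : Tendsto (fun z ↦ (z - p) • g z) (𝓝[≠] p) (𝓝 r)) :
    ∃ q : ℂ → E, DifferentiableOn ℂ q U ∧ ∀ z ≠ p, g z = q z + (z - p)⁻¹ • r := by
  set q : ℂ → E := fun z ↦ g z - (z - p)⁻¹ • r with hq
  have hqd : DifferentiableOn ℂ q (U \ {p}) := hg.sub fun z hz ↦
    (((differentiableAt_id.sub_const p).inv (sub_ne_zero.2 hz.2)).smul_const
      r).differentiableWithinAt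
  have hsmall : (fun z ↦ q z - q p) =o[𝓝[≠] p] fun z ↦ (z - p)⁻¹ := by
    have hlim : Tendsto (fun z ↦ (z - p) • q p) (𝓝[≠] p) (𝓝 0) := by
      have : Continuous fun z : ℂ ↦ (z - p) • q p := by fun_prop
      simpa using (this.tendsto p).mono_left nhdsWithin_le_nhds
    have hlim' : Tendsto (fun z ↦ (z - p) • (q z - q p)) (𝓝[≠] p) (𝓝 0) := by
      have := (hr.sub_const r).sub hlim
      simp only [sub_self] at this
      refine this.congr' ?_
      filter_upwards [self_mem_nhdsWithin] with z hz
      simp only [hq, smul_sub, smul_inv_smul₀ (sub_ne_zero.2 hz)]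
    refine ((Asymptotics.isBigO_refl (fun z ↦ (z - p)⁻¹) _).smul_isLittleO
      ((Asymptotics.isLittleO_one_iff ℂ).2 hlim')).congr' ?_ (by simp)
    filter_upwards [self_mem_nhdsWithin] with z hz using inv_smul_smul₀ (sub_ne_zero.2 hz) _
  refine ⟨_, Complex.differentiableOn_update_limUnder_of_isLittleO (hU.mem_nhds hp) hqd hsmall,
    fun z hz ↦ ?_⟩
  rw [Function.update_of_ne hz, hq, sub_add_cancel]

theorem rectIntegral_eq_sum_residues [CompleteSpace E] (hab : a ≤ b) (hcd : c ≤ d) {U : Set ℂ}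
    (hU : IsOpen U) (hsub : Set.Icc a b ×ℂ Set.Icc c d ⊆ U) (S : Finset ℂ) (r : ℂ → E) {g : ℂ → E}
    (hS : ∀ p ∈ S, p ∈ Set.Ioo a b ×ℂ Set.Ioo c d) (hg : DifferentiableOn ℂ g (U \ S))
    (hr : ∀ p ∈ S, Tendsto (fun z ↦ (z - p) • g z) (𝓝[≠] p) (𝓝 (r p))) :
    rectIntegral g a b c d = (2 * π * I) • ∑ p ∈ S, r p := by
  classical
  induction S using Finset.induction_on generalizing g with
  | empty => simp [rectIntegral_eq_zero hab hcd (hg.mono (by simpa using hsub))]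
  | insert p S hpS ih =>
    obtain ⟨hp, hS⟩ := Finset.forall_mem_insert .. |>.1 hS
    obtain ⟨hrp, hr⟩ := Finset.forall_mem_insert .. |>.1 hr
    have hpU : p ∈ U := hsub ⟨Set.Ioo_subset_Icc_self hp.1, Set.Ioo_subset_Icc_self hp.2⟩
    obtain ⟨q, hq, hgq⟩ := exists_differentiableOn_sub_simple_pole
      (hU.sdiff S.finite_toSet.isClosed) ⟨hpU, by simpa using hpS⟩
      (hg.mono fun z hz ↦ ⟨hz.1.1, by simpa using ⟨hz.2, hz.1.2⟩⟩) hrp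
    have hpole : ∀ z ≠ p, DifferentiableAt ℂ (fun z ↦ (z - p)⁻¹ • r p) z := fun z hz ↦
      ((differentiableAt_id.sub_const p).inv (sub_ne_zero.2 hz)).smul_const _
    have hqr : ∀ p' ∈ S, Tendsto (fun z ↦ (z - p') • q z) (𝓝[≠] p') (𝓝 (r p')) := by
      intro p' hp'
      have hne : p' ≠ p := ne_of_mem_of_not_mem hp' hpS
      have hlim : Tendsto (fun z ↦ (z - p') • (z - p)⁻¹ • r p) (𝓝[≠] p') (𝓝 0) := by
        have hcont : ContinuousAt (fun z ↦ (z - p') • (z - p)⁻¹ • r p) p' :=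
          (continuousAt_id.sub continuousAt_const).smul (hpole p' hne).continuousAt
        simpa using hcont.tendsto.mono_left nhdsWithin_le_nhds
      refine sub_zero (r p') ▸ ((hr p' hp').sub hlim).congr' ?_
      filter_upwards [mem_nhdsWithin_of_mem_nhds (isOpen_ne.mem_nhds hne)] with z hz
      rw [hgq z hz, smul_add, add_sub_cancel_right]
    have hne : ∀ z ∈ rectBoundary a b c d, z ≠ p := fun z hz h ↦ notMem_rectBoundary hp (h ▸ hz)
    have hqc : ContinuousOn q (rectBoundary a b c d) := hq.continuousOn.mono fun z hz ↦
      ⟨hsub (rectBoundary_subset hz), fun h ↦ notMem_rectBoundary (hS z h) hz⟩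
    rw [rectIntegral_congr hab hcd fun z hz ↦ hgq z (hne z hz),
      rectIntegral_add hab hcd hqc fun z hz ↦ (hpole z (hne z hz)).continuousAt.continuousWithinAt,
      rectIntegral_smul_const, ih hS hq hqr, rectIntegral_inv_sub hp, Finset.sum_insert hpS]
    module

theorem rectIntegral_inv_smul [CompleteSpace E] (hab : a ≤ b) (hcd : c ≤ d) {U : Set ℂ}
    (hU : IsOpen U) (hsub : Set.Icc a b ×ℂ Set.Icc c d ⊆ U) (S : Finset ℂ)
    (hS : ∀ p ∈ S, p ∈ Set.Ioo a b ×ℂ Set.Ioo c d) {F : ℂ → E} (hF : DifferentiableOn ℂ F U)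
    {D D' : ℂ → ℂ} (hD : ∀ z ∈ U, HasDerivAt D (D' z) z) (hD₀ : ∀ z ∈ U, D z = 0 ↔ z ∈ S)
    (hD' : ∀ z ∈ S, D' z ≠ 0) :
    rectIntegral (fun z ↦ (D z)⁻¹ • F z) a b c d = (2 * π * I) • ∑ p ∈ S, (D' p)⁻¹ • F p := by
  refine rectIntegral_eq_sum_residues hab hcd hU hsub S _ hS ?_ fun p hp ↦ ?_
  · refine DifferentiableOn.smul (fun z hz ↦ ?_) (hF.mono Set.sdiff_subset)
    exact ((hD z hz.1).differentiableAt.inv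
      fun h ↦ hz.2 ((hD₀ z hz.1).1 h)).differentiableWithinAt
  · have hpU : p ∈ U := hsub ⟨Set.Ioo_subset_Icc_self (hS p hp).1,
      Set.Ioo_subset_Icc_self (hS p hp).2⟩
    have hslope := (hasDerivAt_iff_tendsto_slope.1 (hD p hpU)).inv₀ (hD' p hp)
    have hFp := (hF.continuousOn.continuousAt (hU.mem_nhds hpU)).tendsto
    refine (hslope.smul (hFp.mono_left nhdsWithin_le_nhds)).congr fun z ↦ ?_
    rw [slope_def_field, (hD₀ p hpU).2 hp, sub_zero, inv_div, div_eq_mul_inv, mul_smul]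

theorem intervalIntegrable_integral_of_continuousOn {F : Type*} [NormedAddCommGroup F]
    [NormedSpace ℝ F] {f : ℝ → ℝ → F} (hf : ContinuousOn (Function.uncurry f)
      (Set.uIcc a b ×ˢ Set.uIcc c d)) :
    IntervalIntegrable (fun x ↦ ∫ y in c..d, f x y) volume a b := by
  have hint := (hf.integrableOn_compact (μ := volume) (isCompact_uIcc.prod isCompact_uIcc)).mono_set
    (Set.prod_mono Set.uIoc_subset_uIcc Set.uIoc_subset_uIcc)
  rw [IntegrableOn, Measure.volume_eq_prod, ← Measure.prod_restrict] at hint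
  rw [intervalIntegrable_iff]
  simp_rw [intervalIntegral.intervalIntegral_eq_integral_uIoc]
  exact hint.integral_prod_left.smul _

theorem integral_rectIntegral_swap {s t : ℝ} (hst : s ≤ t) (hab : a ≤ b) (hcd : c ≤ d)
    {k : ℝ → ℂ → E}
    (hk : ContinuousOn (Function.uncurry k) (Set.Icc s t ×ˢ rectBoundary a b c d)) :
    ∫ u in s..t, rectIntegral (k u) a b c d =
      rectIntegral (fun z ↦ ∫ u in s..t, k u z) a b c d := by
  rw [← Set.uIcc_of_le hst] at hk
  have horizontal {y : ℝ} (hy : y = c ∨ y = d) : ContinuousOn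
      (Function.uncurry fun u x : ℝ ↦ k u (x + y * I)) (Set.uIcc s t ×ˢ Set.uIcc a b) :=
    hk.comp (f := fun q : ℝ × ℝ ↦ (q.1, (q.2 + y * I : ℂ))) (by fun_prop) fun q hq ↦
      ⟨hq.1, horizontal_mem_rectBoundary hcd (Set.uIcc_of_le hab ▸ hq.2) hy⟩
  have vertical {x : ℝ} (hx : x = a ∨ x = b) : ContinuousOn
      (Function.uncurry fun u y : ℝ ↦ k u (x + y * I)) (Set.uIcc s t ×ˢ Set.uIcc c d) :=
    hk.comp (f := fun q : ℝ × ℝ ↦ (q.1, (x + q.2 * I : ℂ))) (by fun_prop) fun q hq ↦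
      ⟨hq.1, vertical_mem_rectBoundary hab hx (Set.uIcc_of_le hcd ▸ hq.2)⟩
  have bottom := intervalIntegrable_integral_of_continuousOn (horizontal (.inl rfl))
  have top := intervalIntegrable_integral_of_continuousOn (horizontal (.inr rfl))
  have right : IntervalIntegrable (fun u ↦ I • ∫ y in c..d, k u (b + y * I)) volume s t :=
    (intervalIntegrable_integral_of_continuousOn (vertical (.inr rfl))).smul I
  have left : IntervalIntegrable (fun u ↦ I • ∫ y in c..d, k u (a + y * I)) volume s t :=
    (intervalIntegrable_integral_of_continuousOn (vertical (.inl rfl))).smul I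
  unfold rectIntegral
  rw [intervalIntegral.integral_sub ((bottom.sub top).add right) left,
    intervalIntegral.integral_add (bottom.sub top) right,
    intervalIntegral.integral_sub bottom top, intervalIntegral.integral_smul,
    intervalIntegral.integral_smul, intervalIntegral_swap_of_continuousOn (horizontal (.inl rfl)),
    intervalIntegral_swap_of_continuousOn (horizontal (.inr rfl)),
    intervalIntegral_swap_of_continuousOn (vertical (.inr rfl)),
    intervalIntegral_swap_of_continuousOn (vertical (.inl rfl))]

theorem norm_rectIntegral_le {g : ℂ → E} {B T V : ℝ} (hcd : c ≤ d)
    (hB : ‖∫ x : ℝ in a..b, g (x + c * I)‖ ≤ B) (hT : ‖∫ x : ℝ in a..b, g (x + d * I)‖ ≤ T)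
    (hV : ∀ y ∈ Set.Icc c d, ∀ x : ℝ, x = a ∨ x = b → ‖g (x + y * I)‖ ≤ V) :
    ‖rectIntegral g a b c d‖ ≤ B + T + 2 * (V * (d - c)) := by
  have hside {x : ℝ} (hx : x = a ∨ x = b) :
      ‖I • ∫ y : ℝ in c..d, g (x + y * I)‖ ≤ V * (d - c) := by
    rw [norm_smul, Complex.norm_I, one_mul, ← abs_of_nonneg (sub_nonneg.2 hcd)]
    refine intervalIntegral.norm_integral_le_of_norm_le_const fun y hy ↦ ?_
    exact hV y (Set.Ioc_subset_Icc_self (Set.uIoc_of_le hcd ▸ hy)) x hx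
  calc ‖rectIntegral g a b c d‖ ≤ B + T + V * (d - c) + V * (d - c) :=
        norm_sub_le_of_le (norm_add_le_of_le (norm_sub_le_of_le hB hT) (hside (.inr rfl)))
          (hside (.inl rfl))
    _ = B + T + 2 * (V * (d - c)) := by ring

end Rectangle

/-! ### The Cauchy transform of the sine -/

/-- The Cauchy transform of `u ↦ sin (c u)` on `[s, t]`. Integrating the contour-integral form of
the Sinc interpolation error over `[s, t]` produces it as a factor. -/
noncomputable def sinCauchy (c s t : ℝ) (z : ℂ) : ℂ :=
  ∫ u in s..t, (Real.sin (c * u) : ℂ) * (z - u)⁻¹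

theorem cos_le_pi_div_two_sub {x : ℝ} (hx : x ≤ π / 2) : Real.cos x ≤ π / 2 - x := by
  rw [← Real.sin_pi_div_two_sub]
  exact Real.sin_le (by linarith)

theorem norm_inv_sub_ofReal {z : ℂ} (hz : z.im ≠ 0) (s : ℝ) :
    ‖(z - s)⁻¹‖ = Real.cos (Real.arctan ((s - z.re) / |z.im|)) / |z.im| := by
  have him : 0 < |z.im| := abs_pos.2 hz
  have hnorm : ‖z - s‖ = √(1 + ((s - z.re) / |z.im|) ^ 2) * |z.im| := by
    rw [Complex.norm_eq_sqrt_sq_add_sq, ← Real.sqrt_sq him.le, ← Real.sqrt_mul (by positivity),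
      Real.sqrt_sq him.le, add_mul, ← mul_pow, div_mul_cancel₀ _ him.ne', one_mul, sq_abs]
    congr 1
    simp only [Complex.sub_re, Complex.ofReal_re, Complex.sub_im, Complex.ofReal_im]
    ring
  rw [norm_inv, hnorm, Real.cos_arctan, div_div, one_div]

theorem sub_ofReal_ne_zero {z : ℂ} (hz : z.im ≠ 0) (s : ℝ) : z - s ≠ 0 :=
  fun h ↦ hz (by simpa using congrArg Complex.im h)

theorem continuous_inv_sub_ofReal {z : ℂ} (hz : z.im ≠ 0) :
    Continuous fun s : ℝ ↦ (z - s)⁻¹ :=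
  Continuous.inv₀ (by fun_prop) (sub_ofReal_ne_zero hz)

theorem sinCauchy_eq {c : ℝ} (hc : c ≠ 0) (s t : ℝ) {z : ℂ} (hz : z.im ≠ 0) :
    sinCauchy c s t z = ((Real.cos (c * s) / c : ℝ) : ℂ) * (z - s)⁻¹ -
      ((Real.cos (c * t) / c : ℝ) : ℂ) * (z - t)⁻¹ +
      ∫ u in s..t, ((Real.cos (c * u) / c : ℝ) : ℂ) * (z - u)⁻¹ ^ 2 := by
  have hcont := continuous_inv_sub_ofReal hz
  have hcos (u : ℝ) : HasDerivAt (fun u : ℝ ↦ ((-(Real.cos (c * u) / c) : ℝ) : ℂ))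
      (Real.sin (c * u) : ℂ) u := by
    have hmul : HasDerivAt (fun u : ℝ ↦ c * u) c u := by simpa using (hasDerivAt_id u).const_mul c
    convert! ((hmul.cos).div_const c).neg.ofReal_comp using 2
    field_simp
  have hinv (u : ℝ) : HasDerivAt (fun u : ℝ ↦ (z - u)⁻¹) ((z - u)⁻¹ ^ 2) u := by
    have hsub : HasDerivAt (fun u : ℝ ↦ z - (u : ℂ)) (-1) u :=
      Complex.ofRealCLM.hasDerivAt.const_sub z
    convert! hsub.inv (sub_ofReal_ne_zero hz u) using 1
    simp
  have hparts := intervalIntegral.integral_deriv_mul_eq_sub (a := s) (b := t)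
    (fun u _ ↦ hcos u) (fun u _ ↦ hinv u)
    (by apply Continuous.intervalIntegrable; fun_prop)
    (by apply Continuous.intervalIntegrable; fun_prop)
  rw [intervalIntegral.integral_add (by apply Continuous.intervalIntegrable; fun_prop)
    (by apply Continuous.intervalIntegrable; fun_prop)] at hparts
  simp only [Complex.ofReal_neg, neg_mul, intervalIntegral.integral_neg] at hparts
  rw [sinCauchy]
  linear_combination hparts

theorem integral_norm_inv_sub_sq (s t : ℝ) {z : ℂ} (hz : z.im ≠ 0) :
    ∫ u : ℝ in s..t, ‖(z - u)⁻¹‖ ^ 2 =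
      (Real.arctan ((t - z.re) / |z.im|) - Real.arctan ((s - z.re) / |z.im|)) / |z.im| := by
  have hcont := continuous_inv_sub_ofReal hz
  rw [sub_div]
  refine intervalIntegral.integral_eq_sub_of_hasDerivAt
    (f := fun u : ℝ ↦ Real.arctan ((u - z.re) / |z.im|) / |z.im|) (fun u _ ↦ ?_)
    (by apply Continuous.intervalIntegrable; fun_prop)
  convert! (((hasDerivAt_id u).sub_const z.re).div_const |z.im|).arctan.div_const |z.im| using 1
  rw [norm_inv_sub_ofReal hz, div_pow, Real.cos_sq_arctan]
  simp only [id]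
  field_simp

theorem norm_sinCauchy_le {c : ℝ} (hc : 0 < c) {s t : ℝ} (hst : s ≤ t) {z : ℂ} (hz : z.im ≠ 0) :
    ‖sinCauchy c s t z‖ ≤ π / (c * |z.im|) := by
  have hcont := continuous_inv_sub_ofReal hz
  have hcos (u : ℝ) : ‖((Real.cos (c * u) / c : ℝ) : ℂ)‖ ≤ c⁻¹ := by
    rw [Complex.norm_real, Real.norm_eq_abs, abs_div, abs_of_pos hc, div_eq_mul_inv]
    exact mul_le_of_le_one_left (by positivity) (Real.abs_cos_le_one _)
  have hint : ‖∫ u in s..t, ((Real.cos (c * u) / c : ℝ) : ℂ) * (z - u)⁻¹ ^ 2‖ ≤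
      c⁻¹ * ∫ u in s..t, ‖(z - u)⁻¹‖ ^ 2 := by
    rw [← intervalIntegral.integral_const_mul]
    refine intervalIntegral.norm_integral_le_of_norm_le hst (Eventually.of_forall fun u _ ↦ ?_)
      (by apply Continuous.intervalIntegrable; fun_prop)
    rw [norm_mul, norm_pow]
    exact mul_le_mul_of_nonneg_right (hcos u) (by positivity)
  have hend (u : ℝ) : ‖((Real.cos (c * u) / c : ℝ) : ℂ) * (z - u)⁻¹‖ ≤ c⁻¹ * ‖(z - u)⁻¹‖ := by
    rw [norm_mul]
    exact mul_le_mul_of_nonneg_right (hcos u) (norm_nonneg _)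
  set θ : ℝ → ℝ := fun u ↦ Real.arctan ((u - z.re) / |z.im|) with hθ
  have hs : Real.cos (θ s) ≤ π / 2 + θ s := by
    rw [← Real.cos_neg, ← sub_neg_eq_add]
    exact cos_le_pi_div_two_sub (by linarith [Real.neg_pi_div_two_lt_arctan ((s - z.re) / |z.im|)])
  have ht : Real.cos (θ t) ≤ π / 2 - θ t := cos_le_pi_div_two_sub (Real.arctan_lt_pi_div_two _).le
  calc ‖sinCauchy c s t z‖
      ≤ c⁻¹ * ‖(z - s)⁻¹‖ + c⁻¹ * ‖(z - t)⁻¹‖ + c⁻¹ * ∫ u in s..t, ‖(z - u)⁻¹‖ ^ 2 := by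
        rw [sinCauchy_eq hc.ne' s t hz]
        exact norm_add_le_of_le (norm_sub_le_of_le (hend s) (hend t)) hint
    _ = (Real.cos (θ s) + Real.cos (θ t) + (θ t - θ s)) / (c * |z.im|) := by
        rw [norm_inv_sub_ofReal hz, norm_inv_sub_ofReal hz, integral_norm_inv_sub_sq s t hz]
        simp only [hθ]
        field_simp
    _ ≤ π / (c * |z.im|) := by
        gcongr
        linarith

theorem norm_sinCauchy_le_of_le_abs_re_sub (c : ℝ) {s t r : ℝ} (hst : s ≤ t) (hr : 0 < r) {z : ℂ}
    (hz : ∀ u ∈ Set.Icc s t, r ≤ |z.re - u|) : ‖sinCauchy c s t z‖ ≤ (t - s) / r := by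
  have hbound : ∀ u ∈ Set.uIoc s t, ‖(Real.sin (c * u) : ℂ) * (z - u)⁻¹‖ ≤ r⁻¹ := by
    intro u hu
    rw [Set.uIoc_of_le hst] at hu
    rw [norm_mul, Complex.norm_real, norm_inv]
    refine (mul_le_of_le_one_left (by positivity) (Real.abs_sin_le_one _)).trans
      (inv_anti₀ hr ((hz u (Set.Ioc_subset_Icc_self hu)).trans ?_))
    simpa using Complex.abs_re_le_norm (z - u)
  simpa only [sinCauchy, abs_of_nonneg (sub_nonneg.2 hst), div_eq_inv_mul] using
    intervalIntegral.norm_integral_le_of_norm_le_const hbound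

/-! ### The Sinc interpolation error as a contour integral -/

theorem norm_sin_sq (z : ℂ) : ‖Complex.sin z‖ ^ 2 = Real.sin z.re ^ 2 + Real.sinh z.im ^ 2 := by
  rw [Complex.sq_norm, Complex.sin_eq, ← Complex.ofReal_sin, ← Complex.ofReal_cos,
    ← Complex.ofReal_cosh, ← Complex.ofReal_sinh, ← Complex.ofReal_mul, ← Complex.ofReal_mul,
    Complex.normSq_add_mul_I, mul_pow, mul_pow, Real.cosh_sq, Real.cos_sq']
  ring

theorem sinh_abs_im_le_norm_sin (z : ℂ) : Real.sinh |z.im| ≤ ‖Complex.sin z‖ := by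
  refine (le_abs_self _).trans (abs_le_of_sq_le_sq ?_ (norm_nonneg _))
  rw [norm_sin_sq, ← Real.abs_sinh, sq_abs]
  exact le_add_of_nonneg_left (sq_nonneg _)

theorem one_le_norm_sin {z : ℂ} (hz : Real.cos z.re = 0) : 1 ≤ ‖Complex.sin z‖ := by
  have hsin : Real.sin z.re ^ 2 = 1 := by simp [Real.sin_sq, hz]
  nlinarith [norm_sin_sq z, norm_nonneg (Complex.sin z), sq_nonneg (Real.sinh z.im)]

theorem sin_pi_div_mul_eq_zero_iff {h : ℝ} (hh : h ≠ 0) {z : ℂ} :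
    Complex.sin (π / h * z) = 0 ↔ ∃ k : ℤ, z = ((k * h : ℝ) : ℂ) := by
  have hh' : (h : ℂ) ≠ 0 := Complex.ofReal_ne_zero.2 hh
  have hπ : (π : ℂ) ≠ 0 := Complex.ofReal_ne_zero.2 Real.pi_ne_zero
  rw [Complex.sin_eq_zero_iff]
  refine exists_congr fun k ↦ ?_
  rw [div_mul_eq_mul_div, div_eq_iff hh', mul_right_comm, mul_comm _ (π : ℂ),
    mul_right_inj' hπ, Complex.ofReal_mul, Complex.ofReal_intCast]

theorem cos_pi_div_mul_node {h : ℝ} (hh : h ≠ 0) (k : ℤ) :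
    Complex.cos (π / h * ((k * h : ℝ) : ℂ)) = (-1) ^ k := by
  have harg : (π / h * ((k * h : ℝ) : ℂ) : ℂ) = ((k * π : ℝ) : ℂ) := by
    have hh' : (h : ℂ) ≠ 0 := Complex.ofReal_ne_zero.2 hh
    push_cast
    field_simp
  rw [harg, ← Complex.ofReal_cos, Real.cos_int_mul_pi]
  push_cast
  rfl

theorem sinc_pi_mul_sub {h x : ℝ} (hh : h ≠ 0) {k : ℤ} (hx : x ≠ k * h) :
    Real.sinc (π * (x / h - k)) =
      Real.sin (π / h * x) * (π / h * ((-1) ^ k * (x - k * h)))⁻¹ := by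
  have hx' : x - k * h ≠ 0 := sub_ne_zero.2 hx
  have harg : π * (x / h - k) = π / h * (x - k * h) := by field_simp
  have harg' : π / h * (x - k * h) = π / h * x - k * π := by field_simp
  have hsign : (((-1 : ℝ) ^ k)⁻¹ : ℝ) = (-1) ^ k := by rw [← inv_zpow, inv_neg_one]
  rw [harg, Real.sinc_of_ne_zero (mul_ne_zero (div_ne_zero Real.pi_ne_zero hh) hx'), harg',
    Real.sin_sub_int_mul_pi, ← harg', mul_inv, mul_inv, hsign, div_eq_mul_inv, mul_inv]
  ring

theorem isOpen_strip (d : ℝ) : IsOpen (strip d) :=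
  isOpen_lt (by fun_prop) continuous_const

theorem sin_pi_div_mul_ne_zero {h x : ℝ} (hh : h ≠ 0) (hx : ∀ k : ℤ, x ≠ k * h) :
    Complex.sin (π / h * x) ≠ 0 := by
  rw [Ne, sin_pi_div_mul_eq_zero_iff hh]
  exact fun ⟨k, hk⟩ ↦ hx k (Complex.ofReal_injective hk)

theorem hasDerivAt_sin_mul_sub (c w z : ℂ) :
    HasDerivAt (fun z ↦ Complex.sin (c * z) * (z - w))
      (c * Complex.cos (c * z) * (z - w) + Complex.sin (c * z)) z := by
  convert! ((hasDerivAt_id z).const_mul c).csin.mul ((hasDerivAt_id z).sub_const w) using 1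
  simp only [id]
  ring

section SincInterpolation

variable {E : Type*} [NormedAddCommGroup E] {d d' h : ℝ} {n : ℕ} {F : ℂ → E}

theorem continuous_comp_horizontal (hF : ContinuousOn F (strip d)) {y : ℝ} (hy : |y| < d) :
    Continuous fun x : ℝ ↦ F (x + y * I) := by
  rw [← continuousOn_univ]
  exact hF.comp (by fun_prop) fun x _ ↦ by simpa [strip] using hy

/-- The Sinc nodes `k * h` with `|k| ≤ n`, the zeros of `sin (π z / h)` enclosed by the contour
through `±(n + 1 / 2) * h`. -/
noncomputable def sincNodes (h : ℝ) (n : ℕ) : Finset ℂ :=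
  (Finset.Icc (-(n : ℤ)) n).image fun k : ℤ ↦ ((k * h : ℝ) : ℂ)

theorem sum_sincNodes (hh : h ≠ 0) (g : ℂ → E) :
    ∑ p ∈ sincNodes h n, g p = ∑ k ∈ Finset.Icc (-(n : ℤ)) n, g ((k * h : ℝ) : ℂ) :=
  Finset.sum_image fun _ _ _ _ hkl ↦ by
    exact_mod_cast mul_right_cancel₀ hh (Complex.ofReal_injective hkl)

theorem mem_sincNodes_iff_sin_eq_zero (hh : 0 < h) {z : ℂ} (hz : |z.re| < (n + 1) * h) :
    z ∈ sincNodes h n ↔ Complex.sin (π / h * z) = 0 := by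
  rw [sin_pi_div_mul_eq_zero_iff hh.ne', sincNodes, Finset.mem_image]
  refine ⟨fun ⟨k, _, hk⟩ ↦ ⟨k, hk.symm⟩, ?_⟩
  rintro ⟨k, rfl⟩
  refine ⟨k, ?_, rfl⟩
  rw [Complex.ofReal_re, abs_mul, abs_of_pos hh, mul_lt_mul_iff_left₀ hh] at hz
  have hk : |k| < n + 1 := by exact_mod_cast hz
  rw [Finset.mem_Icc, ← abs_le]
  lia

theorem sincNodes_subset (hh : 0 < h) (hd' : 0 < d') {p : ℂ} (hp : p ∈ sincNodes h n) :
    p ∈ Set.Ioo (-((n + 1 / 2) * h)) ((n + 1 / 2) * h) ×ℂ Set.Ioo (-d') d' := by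
  obtain ⟨k, hk, rfl⟩ := Finset.mem_image.1 hp
  rw [Finset.mem_Icc, ← abs_le] at hk
  refine ⟨abs_lt.1 ?_, by simp [hd']⟩
  have hk' : |(k : ℝ)| ≤ n := by exact_mod_cast hk
  rw [Complex.ofReal_re, abs_mul, abs_of_pos hh]
  exact mul_lt_mul_of_pos_right (by linarith) hh

theorem sin_ne_zero_of_mem_rectBoundary (hh : 0 < h) (hd' : 0 < d') {z : ℂ}
    (hz : z ∈ rectBoundary (-((n + 1 / 2) * h)) ((n + 1 / 2) * h) (-d') d') :
    Complex.sin (π / h * z) ≠ 0 := by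
  have hre : |z.re| < (n + 1) * h := (abs_le.2 hz.1).trans_lt (by linarith)
  rw [Ne, ← mem_sincNodes_iff_sin_eq_zero hh hre]
  exact fun hz' ↦ notMem_rectBoundary (sincNodes_subset hh hd' hz') hz

variable [NormedSpace ℂ E]

theorem rectIntegral_inv_sin_mul_sub [CompleteSpace E] (hh : 0 < h) (hd' : 0 < d') (hdd : d' < d)
    (hF : DifferentiableOn ℂ F (strip d)) {x : ℝ} (hx : |x| < (n + 1 / 2) * h)
    (hgrid : ∀ k : ℤ, x ≠ k * h) :
    rectIntegral (fun z ↦ (Complex.sin (π / h * z) * (z - x))⁻¹ • F z)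
        (-((n + 1 / 2) * h)) ((n + 1 / 2) * h) (-d') d' =
      (2 * π * I) • ((Complex.sin (π / h * x))⁻¹ • F x + ∑ k ∈ Finset.Icc (-(n : ℤ)) n,
        (π / h * ((-1) ^ k * (k * h - x)) : ℂ)⁻¹ • F ((k * h : ℝ) : ℂ)) := by
  have hh' : (π / h : ℂ) ≠ 0 := by exact_mod_cast (div_pos Real.pi_pos hh).ne'
  have hre : |((x : ℂ)).re| < (n + 1) * h := by rw [Complex.ofReal_re]; linarith
  have hsin := sin_pi_div_mul_ne_zero hh.ne' hgrid
  have hxS : (x : ℂ) ∉ sincNodes h n := by rwa [mem_sincNodes_iff_sin_eq_zero hh hre]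
  have hresidues := rectIntegral_inv_smul (a := -((n + 1 / 2) * h)) (b := (n + 1 / 2) * h)
    (c := -d') (d := d') (by linarith [abs_nonneg x]) (by linarith)
    (U := strip d ∩ {z | |z.re| < (n + 1) * h})
    ((isOpen_strip d).inter (isOpen_lt (by fun_prop) continuous_const))
    (fun z hz ↦ ⟨(abs_le.2 hz.2).trans_lt hdd, (abs_le.2 hz.1).trans_lt (by linarith)⟩)
    (insert (x : ℂ) (sincNodes h n))
    (fun p hp ↦ (Finset.mem_insert.1 hp).elim
      (fun hp ↦ hp ▸ ⟨abs_lt.1 hx, by simp [hd']⟩) (sincNodes_subset hh hd'))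
    (hF.mono Set.inter_subset_left)
    (D := fun z ↦ Complex.sin (π / h * z) * (z - x))
    (D' := fun z ↦ π / h * Complex.cos (π / h * z) * (z - x) + Complex.sin (π / h * z))
    (fun z _ ↦ hasDerivAt_sin_mul_sub _ _ _)
    (fun z hz ↦ by
      rw [Finset.mem_insert, mem_sincNodes_iff_sin_eq_zero hh hz.2, mul_eq_zero, sub_eq_zero,
        or_comm])
    (fun z hz ↦ by
      rcases Finset.mem_insert.1 hz with rfl | hz
      · simpa using hsin
      · obtain ⟨k, -, rfl⟩ := Finset.mem_image.1 hz
        have hsub : ((k * h : ℝ) : ℂ) - x ≠ 0 :=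
          sub_ne_zero.2 fun hxk ↦ hgrid k (Complex.ofReal_injective hxk).symm
        rw [cos_pi_div_mul_node hh.ne', (sin_pi_div_mul_eq_zero_iff hh.ne').2 ⟨k, rfl⟩, add_zero]
        exact mul_ne_zero (mul_ne_zero hh' (zpow_ne_zero _ (by norm_num))) hsub)
  rw [hresidues, Finset.sum_insert hxS, sub_self, mul_zero, zero_add, sum_sincNodes hh.ne'
    (fun p ↦ (π / h * Complex.cos (π / h * p) * (p - x) + Complex.sin (π / h * p))⁻¹ • F p)]
  congr 2
  refine Finset.sum_congr rfl fun k _ ↦ ?_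
  rw [cos_pi_div_mul_node hh.ne', (sin_pi_div_mul_eq_zero_iff hh.ne').2 ⟨k, rfl⟩, add_zero,
    mul_assoc, Complex.ofReal_mul, Complex.ofReal_intCast]

theorem sinc_interpolation_error_eq [CompleteSpace E] (hh : 0 < h) (hd' : 0 < d') (hdd : d' < d)
    (hF : DifferentiableOn ℂ F (strip d)) {x : ℝ} (hx : |x| < (n + 1 / 2) * h)
    (hgrid : ∀ k : ℤ, x ≠ k * h) :
    rectIntegral (fun z ↦ ((Real.sin (π / h * x) : ℂ) * (z - x)⁻¹) •
        (Complex.sin (π / h * z))⁻¹ • F z) (-((n + 1 / 2) * h)) ((n + 1 / 2) * h) (-d') d' =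
      (2 * π * I) • (F x - ∑ k ∈ Finset.Icc (-(n : ℤ)) n,
        Real.sinc (π * (x / h - k)) • F ((k * h : ℝ) : ℂ)) := by
  have hsin := sin_pi_div_mul_ne_zero hh.ne' hgrid
  have hfun : (fun z : ℂ ↦ ((Real.sin (π / h * x) : ℂ) * (z - x)⁻¹) •
      (Complex.sin (π / h * z))⁻¹ • F z) =
      fun z : ℂ ↦ Complex.sin (π / h * x) • (Complex.sin (π / h * z) * (z - x))⁻¹ • F z := by
    ext z
    rw [smul_smul, smul_smul, mul_inv]
    push_cast
    congr 1
    ring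
  rw [hfun, rectIntegral_const_smul, rectIntegral_inv_sin_mul_sub hh hd' hdd hF hx hgrid,
    smul_comm]
  congr 1
  rw [smul_add, smul_inv_smul₀ hsin, sub_eq_add_neg, ← Finset.sum_neg_distrib, Finset.smul_sum]
  congr 1
  refine Finset.sum_congr rfl fun k _ ↦ ?_
  rw [sinc_pi_mul_sub hh.ne' (hgrid k), ← Complex.coe_smul, ← neg_smul, smul_smul]
  congr 1
  push_cast
  rw [← neg_sub (x : ℂ) (k * h), mul_neg, mul_neg, inv_neg, mul_neg]

end SincInterpolation

section SincIndefiniteIntegration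

variable {E : Type*} [NormedAddCommGroup E] [NormedSpace ℂ E] {d d' h s t : ℝ} {n : ℕ} {F : ℂ → E}

theorem continuousOn_sinc_error_kernel (hh : 0 < h) (hd' : 0 < d') (hdd : d' < d)
    (hF : ContinuousOn F (strip d)) (hs : -((n + 1 / 2) * h) < s) (ht : t < (n + 1 / 2) * h) :
    ContinuousOn (Function.uncurry fun (u : ℝ) (z : ℂ) ↦
        ((Real.sin (π / h * u) : ℂ) * (z - u)⁻¹) • (Complex.sin (π / h * z))⁻¹ • F z)
      (Set.Icc s t ×ˢ rectBoundary (-((n + 1 / 2) * h)) ((n + 1 / 2) * h) (-d') d') := by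
  have hne : ∀ q ∈ Set.Icc s t ×ˢ
      rectBoundary (-((n + 1 / 2) * h)) ((n + 1 / 2) * h) (-d') d', q.2 - (q.1 : ℂ) ≠ 0 := by
    refine fun q hq ↦ sub_ne_zero.2 fun heq ↦ notMem_rectBoundary
      (p := (q.1 : ℂ)) ⟨⟨hs.trans_le hq.1.1, hq.1.2.trans_lt ht⟩, by simp [hd']⟩ (heq ▸ hq.2)
  refine ContinuousOn.smul (ContinuousOn.mul (by fun_prop) (ContinuousOn.inv₀ (by fun_prop) hne))
    (ContinuousOn.smul (ContinuousOn.inv₀ (by fun_prop)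
      fun q hq ↦ sin_ne_zero_of_mem_rectBoundary hh hd' hq.2)
      (hF.comp continuousOn_snd fun q hq ↦ (abs_le.2 hq.2.2.1).trans_lt hdd))

theorem rectIntegral_sinCauchy_smul [CompleteSpace E] (hh : 0 < h) (hd' : 0 < d') (hdd : d' < d)
    (hF : DifferentiableOn ℂ F (strip d)) (hst : s ≤ t) (hs : -((n + 1 / 2) * h) < s)
    (ht : t < (n + 1 / 2) * h) :
    rectIntegral (fun z ↦ sinCauchy (π / h) s t z • (Complex.sin (π / h * z))⁻¹ • F z)
        (-((n + 1 / 2) * h)) ((n + 1 / 2) * h) (-d') d' =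
      (2 * π * I) • ((∫ u : ℝ in s..t, F u) - ∑ k ∈ Finset.Icc (-(n : ℤ)) n,
        (J k h t - J k h s) • F ((k * h : ℝ) : ℂ)) := by
  have hline : IntervalIntegrable (fun u : ℝ ↦ F u) volume s t := by
    simpa using (continuous_comp_horizontal hF.continuousOn (y := 0)
      (by simpa using hd'.trans hdd)).intervalIntegrable s t
  have hterm (k : ℤ) : IntervalIntegrable
      (fun u : ℝ ↦ Real.sinc (π * (u / h - k)) • F ((k * h : ℝ) : ℂ)) volume s t := by
    apply Continuous.intervalIntegrable
    fun_prop
  have hsum : IntervalIntegrable (fun u : ℝ ↦ ∑ k ∈ Finset.Icc (-(n : ℤ)) n,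
      Real.sinc (π * (u / h - k)) • F ((k * h : ℝ) : ℂ)) volume s t := by
    simpa only [Finset.sum_fn] using IntervalIntegrable.sum _ fun k _ ↦ hterm k
  have hae : ∀ᵐ u : ℝ, u ∈ Set.uIoc s t →
      rectIntegral (fun z ↦ ((Real.sin (π / h * u) : ℂ) * (z - u)⁻¹) •
          (Complex.sin (π / h * z))⁻¹ • F z) (-((n + 1 / 2) * h)) ((n + 1 / 2) * h) (-d') d' =
        (2 * π * I) • (F u - ∑ k ∈ Finset.Icc (-(n : ℤ)) n,
          Real.sinc (π * (u / h - k)) • F ((k * h : ℝ) : ℂ)) := by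
    filter_upwards [(Set.countable_range fun k : ℤ ↦ (k * h : ℝ)).ae_notMem volume] with u hu hmem
    rw [Set.uIoc_of_le hst] at hmem
    exact sinc_interpolation_error_eq hh hd' hdd hF
      (abs_lt.2 ⟨hs.trans hmem.1, hmem.2.trans_lt ht⟩) fun k hk ↦ hu ⟨k, hk.symm⟩
  simp only [sinCauchy, ← intervalIntegral.integral_smul_const]
  rw [← integral_rectIntegral_swap hst (by linarith) (by linarith)
      (continuousOn_sinc_error_kernel hh hd' hdd hF.continuousOn hs ht),
    intervalIntegral.integral_congr_ae hae, intervalIntegral.integral_smul,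
    intervalIntegral.integral_sub hline hsum, intervalIntegral.integral_finsetSum fun k _ ↦ hterm k]
  simp only [intervalIntegral.integral_smul_const, integral_sinc_eq_J_sub _ hh.ne']

theorem sinh_le_norm_sin_horizontal (hh : 0 < h) (x : ℝ) {y : ℝ} (hy : |y| = d') :
    Real.sinh (π * d' / h) ≤ ‖Complex.sin (π / h * (x + y * I))‖ := by
  refine le_of_eq_of_le ?_ (sinh_abs_im_le_norm_sin _)
  rw [← Complex.ofReal_div, Complex.im_ofReal_mul, abs_mul, abs_of_pos (div_pos Real.pi_pos hh)]
  simp [hy, mul_div_right_comm]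

theorem one_le_norm_sin_vertical (hh : h ≠ 0) {x : ℝ}
    (hx : x = -((n + 1 / 2) * h) ∨ x = (n + 1 / 2) * h) (y : ℝ) :
    1 ≤ ‖Complex.sin (π / h * (x + y * I))‖ := by
  have hcos : Real.cos (π / h * ((n + 1 / 2) * h)) = 0 :=
    Real.cos_eq_zero_iff.2 ⟨n, by push_cast; field_simp⟩
  refine one_le_norm_sin ?_
  rw [← Complex.ofReal_div, Complex.re_ofReal_mul]
  rcases hx with rfl | rfl <;> simpa using hcos

theorem norm_integral_horizontal_le (hh : 0 < h) (hd' : 0 < d') (hdd : d' < d)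
    (hF : ContinuousOn F (strip d)) (hst : s ≤ t) {R y N₁ : ℝ} (hR : 0 ≤ R) (hy : |y| = d')
    (hN : ∫ x : ℝ in -R..R, ‖F (x + y * I)‖ ≤ N₁) :
    ‖∫ x : ℝ in -R..R, sinCauchy (π / h) s t (x + y * I) •
        (Complex.sin (π / h * (x + y * I)))⁻¹ • F (x + y * I)‖ ≤
      h / (d' * Real.sinh (π * d' / h)) * N₁ := by
  have hcauchy (x : ℝ) : ‖sinCauchy (π / h) s t (x + y * I)‖ ≤ h / d' := by
    have him : ((x : ℂ) + y * I).im = y := by simp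
    have hy₀ : y ≠ 0 := abs_pos.1 (hy ▸ hd')
    refine (norm_sinCauchy_le (div_pos Real.pi_pos hh) hst (him.symm ▸ hy₀)).trans_eq ?_
    rw [him, hy]
    field_simp
  have hpoint (x : ℝ) : ‖sinCauchy (π / h) s t (x + y * I) •
      (Complex.sin (π / h * (x + y * I)))⁻¹ • F (x + y * I)‖ ≤
      h / (d' * Real.sinh (π * d' / h)) * ‖F (x + y * I)‖ := by
    rw [norm_smul, norm_smul, norm_inv, ← mul_assoc, ← div_div, div_eq_mul_inv (h / d')]
    gcongr
    exacts [hcauchy x, sinh_le_norm_sin_horizontal hh x hy]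
  calc _ ≤ ∫ x : ℝ in -R..R, h / (d' * Real.sinh (π * d' / h)) * ‖F (x + y * I)‖ :=
        intervalIntegral.norm_integral_le_of_norm_le (by linarith)
          (Eventually.of_forall fun x _ ↦ hpoint x) <| Continuous.intervalIntegrable
            ((continuous_comp_horizontal hF (hy.trans_lt hdd)).norm.const_mul _) _ _
    _ ≤ h / (d' * Real.sinh (π * d' / h)) * N₁ := by
        rw [intervalIntegral.integral_const_mul]
        gcongr

theorem norm_vertical_le (hh : h ≠ 0) (hst : s ≤ t) {Y B x y : ℝ} (hs : -Y ≤ s) (ht : t ≤ Y)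
    (hY : Y < (n + 1 / 2) * h) (hx : x = -((n + 1 / 2) * h) ∨ x = (n + 1 / 2) * h)
    (hB : ‖F (x + y * I)‖ ≤ B) :
    ‖sinCauchy (π / h) s t (x + y * I) • (Complex.sin (π / h * (x + y * I)))⁻¹ •
      F (x + y * I)‖ ≤ (t - s) / ((n + 1 / 2) * h - Y) * B := by
  have hY₀ : 0 < (n + 1 / 2) * h - Y := sub_pos.2 hY
  have hcauchy : ‖sinCauchy (π / h) s t (x + y * I)‖ ≤ (t - s) / ((n + 1 / 2) * h - Y) := by
    refine norm_sinCauchy_le_of_le_abs_re_sub _ hst hY₀ fun u hu ↦ ?_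
    have hre : ((x : ℂ) + y * I).re = x := by simp
    rw [hre, le_abs]
    rcases hx with rfl | rfl
    · exact .inr (by linarith [hu.1])
    · exact .inl (by linarith [hu.2])
  have hsin : ‖(Complex.sin (π / h * (x + y * I)))⁻¹‖ ≤ 1 := by
    rw [norm_inv]
    exact inv_le_one_of_one_le₀ (one_le_norm_sin_vertical hh hx y)
  rw [norm_smul, norm_smul]
  gcongr
  exact (mul_le_of_le_one_left (norm_nonneg _) hsin).trans hB

theorem norm_integral_sub_sum_Icc_le [CompleteSpace E] (hh : 0 < h) (hd' : 0 < d') (hdd : d' < d)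
    (hF : DifferentiableOn ℂ F (strip d)) {B N₁ : ℝ} (hB : ∀ z : ℂ, |z.im| ≤ d' → ‖F z‖ ≤ B)
    (hN : ∀ R : ℝ, 0 ≤ R → ∀ y : ℝ, |y| = d' → ∫ x : ℝ in -R..R, ‖F (x + y * I)‖ ≤ N₁)
    (n : ℕ) {Y : ℝ} (hst : s ≤ t) (hs : -Y ≤ s) (ht : t ≤ Y) (hY : Y < (n + 1 / 2) * h) :
    ‖(∫ u : ℝ in s..t, F u) -
        ∑ k ∈ Finset.Icc (-(n : ℤ)) n, (J k h t - J k h s) • F ((k * h : ℝ) : ℂ)‖ ≤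
      h * N₁ / (π * d' * Real.sinh (π * d' / h)) +
        2 * d' * B / π * ((t - s) / ((n + 1 / 2) * h - Y)) := by
  have hR : 0 ≤ (n + 1 / 2) * h := by positivity
  have hhor {y : ℝ} (hy : |y| = d') :=
    norm_integral_horizontal_le hh hd' hdd hF.continuousOn hst hR hy (hN _ hR y hy)
  have hrect := norm_rectIntegral_le
    (g := fun z ↦ sinCauchy (π / h) s t z • (Complex.sin (π / h * z))⁻¹ • F z)
    (a := -((n + 1 / 2) * h)) (c := -d') (by linarith)
    (hhor (by rw [abs_neg, abs_of_pos hd'])) (hhor (abs_of_pos hd'))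
    fun y hy x hx ↦ norm_vertical_le hh.ne' hst hs ht hY hx (hB _ (by simpa using abs_le.2 hy))
  rw [rectIntegral_sinCauchy_smul hh hd' hdd hF hst (by linarith) (by linarith), norm_smul,
    show ‖(2 * π * I : ℂ)‖ = 2 * π by simp [Real.pi_pos.le],
    ← le_div_iff₀' (by positivity)] at hrect
  refine hrect.trans_eq ?_
  field_simp
  ring

theorem norm_J_sub_smul_le (k : ℤ) (hh : 0 ≤ h) (s t : ℝ) (v : E) :
    ‖(J k h t - J k h s) • v‖ ≤ 3 * h * ‖v‖ := by
  rw [norm_smul, Real.norm_eq_abs]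
  gcongr
  linarith [abs_sub (J k h t) (J k h s), abs_J_le k hh t, abs_J_le k hh s]

theorem norm_integral_sub_tsum_le [CompleteSpace E] (hh : 0 < h) (hd' : 0 < d') (hdd : d' < d)
    (hF : DifferentiableOn ℂ F (strip d)) {B N₁ : ℝ} (hB : ∀ z : ℂ, |z.im| ≤ d' → ‖F z‖ ≤ B)
    (hN : ∀ R : ℝ, 0 ≤ R → ∀ y : ℝ, |y| = d' → ∫ x : ℝ in -R..R, ‖F (x + y * I)‖ ≤ N₁)
    (hsum : Summable fun k : ℤ ↦ ‖F ((k * h : ℝ) : ℂ)‖) (hst : s ≤ t) :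
    ‖(∫ u : ℝ in s..t, F u) - ∑' k : ℤ, (J k h t - J k h s) • F ((k * h : ℝ) : ℂ)‖ ≤
      h * N₁ / (π * d' * Real.sinh (π * d' / h)) := by
  have hR : Tendsto (fun n : ℕ ↦ ((n : ℝ) + 1 / 2) * h) atTop atTop :=
    (tendsto_atTop_add_const_right _ _ tendsto_natCast_atTop_atTop).atTop_mul_const hh
  have hsumJ : Summable fun k : ℤ ↦ (J k h t - J k h s) • F ((k * h : ℝ) : ℂ) :=
    .of_norm_bounded (hsum.mul_left (3 * h)) fun k ↦ norm_J_sub_smul_le k hh.le s t _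
  have hleft := ((hsumJ.hasSum.comp (Finset.tendsto_Icc_neg (R := ℤ))).const_sub
    (∫ u : ℝ in s..t, F u)).norm
  have hright := ((tendsto_const_nhds (x := t - s).div_atTop
    (tendsto_atTop_add_const_right _ (-max (-s) t) hR)).const_mul (2 * d' * B / π)).const_add
    (h * N₁ / (π * d' * Real.sinh (π * d' / h)))
  rw [mul_zero, add_zero] at hright
  refine le_of_tendsto_of_tendsto hleft hright ?_
  filter_upwards [hR.eventually_gt_atTop (max (-s) t)] with n hn
  exact norm_integral_sub_sum_Icc_le hh hd' hdd hF hB hN n hst (neg_le.1 (le_max_left _ _))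
    (le_max_right _ _) hn

theorem norm_sub_tsum_J_le [CompleteSpace E] (hh : 0 < h) (hd' : 0 < d') (hdd : d' < d)
    (hF : DifferentiableOn ℂ F (strip d)) {B N₁ : ℝ} (hB : ∀ z : ℂ, |z.im| ≤ d' → ‖F z‖ ≤ B)
    (hN : ∀ R : ℝ, 0 ≤ R → ∀ y : ℝ, |y| = d' → ∫ x : ℝ in -R..R, ‖F (x + y * I)‖ ≤ N₁)
    (hsum : Summable fun k : ℤ ↦ ‖F ((k * h : ℝ) : ℂ)‖) {v : E}
    (hv : Tendsto (fun s : ℝ ↦ ∫ u : ℝ in s..t, F u) atBot (𝓝 v)) :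
    ‖v - ∑' k : ℤ, J k h t • F ((k * h : ℝ) : ℂ)‖ ≤
      h * N₁ / (π * d' * Real.sinh (π * d' / h)) := by
  have hseries : Tendsto (fun s : ℝ ↦ ∑' k : ℤ, (J k h t - J k h s) • F ((k * h : ℝ) : ℂ)) atBot
      (𝓝 (∑' k : ℤ, J k h t • F ((k * h : ℝ) : ℂ))) :=
    tendsto_tsum_of_dominated_convergence (hsum.mul_left (3 * h))
      (fun k ↦ by
        simpa using ((tendsto_J_atBot k hh).const_sub (J k h t)).smul_const (F ((k * h : ℝ) : ℂ)))
      (Eventually.of_forall fun s k ↦ norm_J_sub_smul_le k hh.le s t _)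
  refine le_of_tendsto (hv.sub hseries).norm ((eventually_le_atBot t).mono fun s hs ↦ ?_)
  exact norm_integral_sub_tsum_le hh hd' hdd hF hB hN hsum hs

end SincIndefiniteIntegration

/-! ### The double-exponential map on the strip -/

theorem mul_cos_le_mul_sin {a : ℝ} (ha : 0 ≤ a) (ha' : a ≤ π / 2) :
    a * Real.cos a ≤ (π ^ 2 / 4 - a ^ 2) * Real.sin a := by
  calc a * Real.cos a ≤ a * (π / 2 - a) := by gcongr; exact cos_le_pi_div_two_sub ha'
    _ ≤ a * (π / 2 - a) + 2 / π * (a ^ 2 * (π / 2 - a)) :=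
        le_add_of_nonneg_right (by positivity)
    _ = (π / 2 - a) * (π / 2 + a) * (2 / π * a) := by field
    _ ≤ (π / 2 - a) * (π / 2 + a) * Real.sin a := by gcongr; exact Real.mul_le_sin ha ha'
    _ = (π ^ 2 / 4 - a ^ 2) * Real.sin a := by ring

theorem one_add_sq_div_two_le_cosh (t : ℝ) : 1 + t ^ 2 / 2 ≤ Real.cosh t := by
  have hcosh : Real.cosh t = 1 + 2 * Real.sinh (t / 2) ^ 2 := by
    conv_lhs => rw [← mul_div_cancel₀ t (two_ne_zero' ℝ), Real.cosh_two_mul,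
      Real.cosh_sq]
    ring
  have hsinh : (t / 2) ^ 2 ≤ Real.sinh (t / 2) ^ 2 := by
    rw [sq_le_sq, Real.abs_sinh]
    exact Real.self_le_sinh_iff.mpr (abs_nonneg _)
  linarith

theorem abs_sin_mul_cosh_le_add {a : ℝ} (ha : 0 ≤ a) (ha' : a ≤ π / 2) (x : ℝ) :
    |Real.sin (a * Real.cosh x)| ≤ Real.sin a + a * Real.cos a * (Real.cosh x - 1) := by
  have hsin : 0 ≤ Real.sin a := Real.sin_nonneg_of_nonneg_of_le_pi ha (by linarith)
  have hcos : 0 ≤ Real.cos a := Real.cos_nonneg_of_neg_pi_div_two_le_of_le (by linarith) ha'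
  have ht : 0 ≤ a * (Real.cosh x - 1) := mul_nonneg ha (sub_nonneg.mpr (Real.one_le_cosh x))
  calc |Real.sin (a * Real.cosh x)| = |Real.sin (a + a * (Real.cosh x - 1))| := by ring_nf
    _ ≤ |Real.sin a * Real.cos (a * (Real.cosh x - 1))|
        + |Real.cos a * Real.sin (a * (Real.cosh x - 1))| := by
        rw [Real.sin_add]
        exact abs_add_le _ _
    _ ≤ Real.sin a * 1 + Real.cos a * (a * (Real.cosh x - 1)) := by
        rw [abs_mul, abs_mul, abs_of_nonneg hsin, abs_of_nonneg hcos]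
        gcongr
        · exact Real.abs_cos_le_one _
        · exact Real.abs_sin_le_abs.trans_eq (abs_of_nonneg ht)
    _ = _ := by ring

theorem abs_sin_mul_cosh_le {a b : ℝ} (ha : |a| ≤ π / 2) (hab : a ^ 2 + b ^ 2 = π ^ 2 / 4)
    (x : ℝ) : |Real.sin (a * Real.cosh x)| ≤ Real.cosh (b * Real.sinh x) * |Real.sin a| := by
  wlog h0 : 0 ≤ a generalizing a
  · simpa only [neg_mul, Real.sin_neg, abs_neg] using
      this (a := -a) (by rwa [abs_neg]) (by rwa [neg_sq]) (by linarith)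
  rw [abs_of_nonneg h0] at ha
  have hsin : 0 ≤ Real.sin a := Real.sin_nonneg_of_nonneg_of_le_pi h0 (by linarith)
  have hcosh : 0 ≤ Real.cosh x - 1 := sub_nonneg.mpr (Real.one_le_cosh x)
  calc |Real.sin (a * Real.cosh x)|
      ≤ Real.sin a + a * Real.cos a * (Real.cosh x - 1) := abs_sin_mul_cosh_le_add h0 ha x
    _ ≤ Real.sin a + b ^ 2 * Real.sin a * (Real.cosh x - 1) := by
        rw [eq_sub_of_add_eq' hab]
        gcongr _ + ?_ * _
        exact mul_cos_le_mul_sin h0 ha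
    _ = (1 + b ^ 2 * (Real.cosh x - 1)) * Real.sin a := by ring
    _ ≤ (1 + (b * Real.sinh x) ^ 2 / 2) * Real.sin a := by
        gcongr ?_ * _
        rw [mul_pow, Real.sinh_sq]
        nlinarith [mul_nonneg (sq_nonneg b) (sq_nonneg (Real.cosh x - 1))]
    _ ≤ Real.cosh (b * Real.sinh x) * |Real.sin a| := by
        rw [abs_of_nonneg hsin]
        gcongr
        exact one_add_sq_div_two_le_cosh _

theorem norm_cosh_sq (w : ℂ) :
    ‖Complex.cosh w‖ ^ 2 = Real.cosh w.re ^ 2 - Real.sin w.im ^ 2 := by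
  have hsin : Complex.sin (w * I + (π / 2 : ℝ)) = Complex.cosh w := by
    rw [Complex.ofReal_div, Complex.ofReal_ofNat, Complex.sin_add_pi_div_two, Complex.cos_mul_I]
  rw [← hsin, norm_sin_sq, Real.cosh_sq]
  simp [← sub_eq_neg_add, Real.sin_pi_div_two_sub, Real.cos_sq']
  ring

theorem norm_cosh_le (ζ : ℂ) : ‖Complex.cosh ζ‖ ≤ Real.cosh ζ.re := by
  refine le_of_sq_le_sq ?_ (Real.cosh_pos _).le
  rw [norm_cosh_sq]
  exact sub_le_self _ (sq_nonneg _)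

theorem pi_div_two_mul_sinh_eq (ζ : ℂ) : (π / 2 : ℂ) * Complex.sinh ζ =
    (π / 2 * (Real.sinh ζ.re * Real.cos ζ.im) : ℝ) +
      (π / 2 * (Real.cosh ζ.re * Real.sin ζ.im) : ℝ) * I := by
  conv_lhs => rw [← Complex.re_add_im ζ, Complex.sinh_add, Complex.cosh_mul_I, Complex.sinh_mul_I]
  push_cast
  ring

theorem pi_div_two_mul_sinh_re (ζ : ℂ) :
    ((π / 2 : ℂ) * Complex.sinh ζ).re = π / 2 * (Real.sinh ζ.re * Real.cos ζ.im) := by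
  rw [pi_div_two_mul_sinh_eq, Complex.add_re, Complex.mul_I_re, Complex.ofReal_re,
    Complex.ofReal_im, neg_zero, add_zero]

theorem pi_div_two_mul_sinh_im (ζ : ℂ) :
    ((π / 2 : ℂ) * Complex.sinh ζ).im = π / 2 * (Real.cosh ζ.re * Real.sin ζ.im) := by
  rw [pi_div_two_mul_sinh_eq, Complex.add_im, Complex.mul_I_im, Complex.ofReal_re,
    Complex.ofReal_im, zero_add]

theorem cosh_mul_cos_le_norm_cosh (ζ : ℂ) :
    Real.cosh (π / 2 * (Real.sinh ζ.re * Real.cos ζ.im)) * Real.cos (π / 2 * Real.sin ζ.im) ≤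
      ‖Complex.cosh (π / 2 * Complex.sinh ζ)‖ := by
  refine le_of_sq_le_sq ?_ (norm_nonneg _)
  rw [norm_cosh_sq, pi_div_two_mul_sinh_re, pi_div_two_mul_sinh_im, mul_pow, Real.cos_sq', mul_sub,
    mul_one]
  have ha : |π / 2 * Real.sin ζ.im| ≤ π / 2 := by
    rw [abs_mul, abs_of_pos Real.pi_div_two_pos]
    exact mul_le_of_le_one_right Real.pi_div_two_pos.le (Real.abs_sin_le_one _)
  have hab : (π / 2 * Real.sin ζ.im) ^ 2 + (π / 2 * Real.cos ζ.im) ^ 2 = π ^ 2 / 4 := by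
    linear_combination π ^ 2 / 4 * Real.sin_sq_add_cos_sq ζ.im
  have hsin := abs_sin_mul_cosh_le ha hab ζ.re
  rw [← abs_of_pos (Real.cosh_pos (_ * _)), ← abs_mul, ← sq_le_sq, mul_pow] at hsin
  have hre : π / 2 * (Real.sinh ζ.re * Real.cos ζ.im) = π / 2 * Real.cos ζ.im * Real.sinh ζ.re := by
    ring
  have him : π / 2 * (Real.cosh ζ.re * Real.sin ζ.im) = π / 2 * Real.sin ζ.im * Real.cosh ζ.re := by
    ring
  rw [hre, him]
  exact sub_le_sub_left hsin _

theorem norm_deMap (ζ : ℂ) :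
    ‖deMap ζ‖ = Real.exp (π / 2 * (Real.sinh ζ.re * Real.cos ζ.im)) := by
  rw [deMap, Complex.norm_exp, pi_div_two_mul_sinh_re]

theorem hasDerivAt_deMap (ζ : ℂ) :
    HasDerivAt deMap (deMap ζ * (π / 2 * Complex.cosh ζ)) ζ :=
  ((Complex.hasDerivAt_sinh ζ).const_mul _).cexp

theorem norm_deriv_deMap_le (ζ : ℂ) : ‖deriv deMap ζ‖ ≤ π / 2 * Real.cosh ζ.re * ‖deMap ζ‖ := by
  rw [(hasDerivAt_deMap ζ).deriv, norm_mul, norm_mul, norm_div, Complex.norm_real,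
    Complex.norm_ofNat, Real.norm_of_nonneg Real.pi_pos.le, mul_comm]
  gcongr
  exact norm_cosh_le ζ

theorem one_add_deMap_sq (ζ : ℂ) :
    1 + deMap ζ ^ 2 = 2 * deMap ζ * Complex.cosh (π / 2 * Complex.sinh ζ) := by
  rw [Complex.cosh, deMap, Complex.exp_neg]
  field [Complex.exp_ne_zero]

theorem one_add_norm_deMap_sq_mul_cos_le (ζ : ℂ) :
    (1 + ‖deMap ζ‖ ^ 2) * Real.cos (π / 2 * Real.sin ζ.im) ≤ ‖1 + deMap ζ ^ 2‖ := by
  have hcosh : 1 + ‖deMap ζ‖ ^ 2 =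
      2 * ‖deMap ζ‖ * Real.cosh (π / 2 * (Real.sinh ζ.re * Real.cos ζ.im)) := by
    rw [Real.cosh_eq, norm_deMap, Real.exp_neg]
    field
  rw [hcosh, one_add_deMap_sq, norm_mul, norm_mul, Complex.norm_ofNat, mul_assoc]
  gcongr
  exact cosh_mul_cos_le_norm_cosh ζ

theorem cos_pi_div_two_mul_sin_pos {y : ℝ} (hy : |y| < π / 2) :
    0 < Real.cos (π / 2 * Real.sin y) := by
  have hcos : 0 < Real.cos y := Real.cos_pos_of_mem_Ioo (abs_lt.mp hy)
  have hsin : |Real.sin y| < 1 := by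
    rw [← sq_lt_one_iff_abs_lt_one, Real.sin_sq]
    linarith [pow_pos hcos 2]
  refine Real.cos_pos_of_mem_Ioo (abs_lt.mp ?_)
  rw [abs_mul, abs_of_pos Real.pi_div_two_pos]
  exact mul_lt_of_lt_one_right Real.pi_div_two_pos hsin

theorem cos_pi_div_two_mul_sin_anti {y d : ℝ} (hd : d ≤ π / 2) (hy : |y| ≤ d) :
    Real.cos (π / 2 * Real.sin d) ≤ Real.cos (π / 2 * Real.sin y) := by
  rw [← Real.cos_abs (π / 2 * Real.sin y), abs_mul, abs_of_pos Real.pi_div_two_pos,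
    Real.abs_sin_eq_sin_abs_of_abs_le_pi (by linarith [Real.pi_pos])]
  have hmono : Real.sin |y| ≤ Real.sin d :=
    Real.sin_le_sin_of_le_of_le_pi_div_two (by linarith [abs_nonneg y]) hd hy
  have hsin : 0 ≤ Real.sin |y| :=
    Real.sin_nonneg_of_nonneg_of_le_pi (abs_nonneg y) (by linarith [Real.pi_pos])
  refine Real.cos_le_cos_of_nonneg_of_le_pi (by positivity) ?_ (by gcongr)
  nlinarith [Real.sin_le_one d, Real.pi_pos]

theorem rpow_div_one_add_sq_rpow_le {ρ α β : ℝ} (hρ : 0 < ρ) (hαβ : 0 ≤ α + β) :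
    ρ ^ α / (1 + ρ ^ 2) ^ ((α + β) / 2) ≤ min (ρ ^ α) (ρ ^ (-β)) := by
  have hp : 0 ≤ (α + β) / 2 := by positivity
  refine le_min (div_le_self (by positivity) (Real.one_le_rpow ?_ hp)) ?_
  · exact le_add_of_nonneg_right (sq_nonneg ρ)
  · rw [div_le_iff₀ (by positivity)]
    calc ρ ^ α = ρ ^ (-β) * (ρ ^ 2) ^ ((α + β) / 2) := by
          rw [← Real.rpow_natCast_mul hρ.le, ← Real.rpow_add hρ]
          congr 1
          push_cast
          ring
      _ ≤ ρ ^ (-β) * (1 + ρ ^ 2) ^ ((α + β) / 2) := by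
          gcongr
          exact le_add_of_nonneg_left zero_le_one

theorem norm_E₂_mul_norm_deMap_le {α β : ℝ} (hαβ : 0 ≤ α + β) {ζ : ℂ} (hζ : |ζ.im| < π / 2) :
    ‖E₂ (deMap ζ) α β‖ * ‖deMap ζ‖ ≤
      min (‖deMap ζ‖ ^ α) (‖deMap ζ‖ ^ (-β)) /
        Real.cos (π / 2 * Real.sin ζ.im) ^ ((α + β) / 2) := by
  have hcos := cos_pi_div_two_mul_sin_pos hζ
  have hρ : 0 < ‖deMap ζ‖ := norm_pos_iff.mpr (Complex.exp_ne_zero _)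
  calc ‖E₂ (deMap ζ) α β‖ * ‖deMap ζ‖
      = ‖deMap ζ‖ ^ α / ‖1 + deMap ζ ^ 2‖ ^ ((α + β) / 2) := by
        rw [E₂, norm_div, Complex.norm_cpow_real, Complex.norm_cpow_real, div_mul_eq_mul_div,
          ← Real.rpow_add_one hρ.ne', sub_add_cancel]
    _ ≤ ‖deMap ζ‖ ^ α /
        ((1 + ‖deMap ζ‖ ^ 2) * Real.cos (π / 2 * Real.sin ζ.im)) ^ ((α + β) / 2) := by
        gcongr
        exact one_add_norm_deMap_sq_mul_cos_le ζ
    _ = ‖deMap ζ‖ ^ α / (1 + ‖deMap ζ‖ ^ 2) ^ ((α + β) / 2) /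
        Real.cos (π / 2 * Real.sin ζ.im) ^ ((α + β) / 2) := by
        rw [Real.mul_rpow (by positivity) hcos.le, div_div]
    _ ≤ _ := by
        gcongr
        exact rpow_div_one_add_sq_rpow_le hρ hαβ

theorem min_norm_deMap_rpow_le {α β e : ℝ} (hα : 0 ≤ α) (hβ : 0 ≤ β) (he : e ≤ π / 2) {ζ : ℂ}
    (hζ : |ζ.im| ≤ e) : min (‖deMap ζ‖ ^ α) (‖deMap ζ‖ ^ (-β)) ≤
      Real.exp (-(π / 2 * min α β * Real.cos e * |Real.sinh ζ.re|)) := by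
  have hcos : Real.cos e ≤ Real.cos ζ.im := by
    rw [← Real.cos_abs ζ.im]
    exact Real.cos_le_cos_of_nonneg_of_le_pi (abs_nonneg _) (by linarith [Real.pi_pos]) hζ
  have hcos' : 0 ≤ Real.cos e :=
    Real.cos_nonneg_of_neg_pi_div_two_le_of_le (by linarith [abs_nonneg ζ.im]) he
  have key {γ : ℝ} (hγ : min α β ≤ γ) (hγ' : 0 ≤ γ) :
      π / 2 * min α β * Real.cos e * |Real.sinh ζ.re| ≤
        π / 2 * (|Real.sinh ζ.re| * Real.cos ζ.im) * γ := by
    calc π / 2 * min α β * Real.cos e * |Real.sinh ζ.re|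
        ≤ π / 2 * γ * Real.cos ζ.im * |Real.sinh ζ.re| := by gcongr
      _ = _ := by ring
  rw [norm_deMap, ← Real.exp_mul, ← Real.exp_mul]
  rcases le_total 0 (Real.sinh ζ.re) with hs | hs
  · refine (min_le_right _ _).trans (Real.exp_le_exp.mpr ?_)
    rw [mul_neg]
    simpa only [abs_of_nonneg hs] using neg_le_neg (key (min_le_right α β) hβ)
  · refine (min_le_left _ _).trans (Real.exp_le_exp.mpr (le_neg_of_le_neg ?_))
    refine (key (min_le_left α β) hα).trans_eq ?_
    rw [abs_of_nonpos hs]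
    ring

section Integrand

variable {E : Type*} [NormedAddCommGroup E] [NormedSpace ℂ E] {f : ℂ → E} {K α β : ℝ}

/-- The integrand `ψ'(ζ) f(ψ(ζ))` obtained by the double-exponential change of variables
`t = ψ(ζ)`. -/
noncomputable def deIntegrand (f : ℂ → E) (ζ : ℂ) : E :=
  deriv deMap ζ • f (deMap ζ)

theorem norm_deIntegrand_le (hK : 0 ≤ K) (hαβ : 0 ≤ α + β) {ζ : ℂ} (hζ : |ζ.im| < π / 2)
    (hf : ‖f (deMap ζ)‖ ≤ K * ‖E₂ (deMap ζ) α β‖) :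
    ‖deIntegrand f ζ‖ ≤ K * (π / 2) / Real.cos (π / 2 * Real.sin ζ.im) ^ ((α + β) / 2) *
      (Real.cosh ζ.re * min (‖deMap ζ‖ ^ α) (‖deMap ζ‖ ^ (-β))) := by
  calc ‖deIntegrand f ζ‖
      ≤ π / 2 * Real.cosh ζ.re * ‖deMap ζ‖ * (K * ‖E₂ (deMap ζ) α β‖) := by
        rw [deIntegrand, norm_smul]
        gcongr
        exact norm_deriv_deMap_le ζ
    _ = K * (π / 2) * Real.cosh ζ.re * (‖E₂ (deMap ζ) α β‖ * ‖deMap ζ‖) := by ring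
    _ ≤ K * (π / 2) * Real.cosh ζ.re * (min (‖deMap ζ‖ ^ α) (‖deMap ζ‖ ^ (-β)) /
          Real.cos (π / 2 * Real.sin ζ.im) ^ ((α + β) / 2)) := by
        gcongr
        exact norm_E₂_mul_norm_deMap_le hαβ hζ
    _ = _ := by ring

theorem norm_deIntegrand_le_of_abs_im_le (hK : 0 ≤ K) (hα : 0 ≤ α) (hβ : 0 ≤ β) {e : ℝ}
    (he : e < π / 2) {ζ : ℂ} (hζ : |ζ.im| ≤ e) (hf : ‖f (deMap ζ)‖ ≤ K * ‖E₂ (deMap ζ) α β‖) :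
    ‖deIntegrand f ζ‖ ≤ K * (π / 2) / Real.cos (π / 2 * Real.sin e) ^ ((α + β) / 2) *
      (Real.cosh ζ.re * Real.exp (-(π / 2 * min α β * Real.cos e * |Real.sinh ζ.re|))) := by
  have hcos : 0 < Real.cos (π / 2 * Real.sin e) :=
    cos_pi_div_two_mul_sin_pos (abs_lt.mpr ⟨by linarith [abs_nonneg ζ.im], he⟩)
  refine (norm_deIntegrand_le hK (add_nonneg hα hβ) (hζ.trans_lt he) hf).trans ?_
  gcongr
  · exact cos_pi_div_two_mul_sin_anti he.le hζ
  · exact min_norm_deMap_rpow_le hα hβ he.le hζ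

end Integrand

theorem continuous_cosh_mul_exp (q : ℝ) :
    Continuous fun x ↦ Real.cosh x * Real.exp (-(q * |Real.sinh x|)) := by
  have := Real.continuous_sinh
  have := Real.continuous_cosh
  fun_prop

theorem hasDerivAt_exp_neg_mul_sinh {q : ℝ} (hq : q ≠ 0) (x : ℝ) :
    HasDerivAt (fun x ↦ -(Real.exp (-(q * Real.sinh x)) / q))
      (Real.cosh x * Real.exp (-(q * Real.sinh x))) x := by
  have hexponent : HasDerivAt (fun x ↦ -(q * Real.sinh x)) (-(q * Real.cosh x)) x :=
    ((Real.hasDerivAt_sinh x).const_mul q).neg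
  convert! (hexponent.exp.div_const q).neg using 1
  field

theorem integral_cosh_mul_exp_eq {q R : ℝ} (hq : q ≠ 0) (hR : 0 ≤ R) :
    ∫ x in 0..R, Real.cosh x * Real.exp (-(q * |Real.sinh x|)) =
      (1 - Real.exp (-(q * Real.sinh R))) / q := by
  have habs : Set.EqOn (fun x ↦ Real.cosh x * Real.exp (-(q * Real.sinh x)))
      (fun x ↦ Real.cosh x * Real.exp (-(q * |Real.sinh x|))) (Set.uIcc 0 R) := fun x hx ↦ by
    rw [Set.uIcc_of_le hR] at hx
    simp only [abs_of_nonneg (Real.sinh_nonneg_iff.mpr hx.1)]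
  rw [← intervalIntegral.integral_congr habs, intervalIntegral.integral_eq_sub_of_hasDerivAt
    (fun x _ ↦ hasDerivAt_exp_neg_mul_sinh hq x)
    ((continuous_cosh_mul_exp q).continuousOn.congr habs).intervalIntegrable]
  simp only [Real.sinh_zero, mul_zero, neg_zero, Real.exp_zero]
  ring

theorem integral_cosh_mul_exp_le {q R : ℝ} (hq : 0 < q) (hR : 0 ≤ R) :
    ∫ x in -R..R, Real.cosh x * Real.exp (-(q * |Real.sinh x|)) ≤ 2 / q := by
  have hint := (continuous_cosh_mul_exp q).intervalIntegrable (μ := volume)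
  have hneg : ∫ x in -R..0, Real.cosh x * Real.exp (-(q * |Real.sinh x|)) =
      ∫ x in 0..R, Real.cosh x * Real.exp (-(q * |Real.sinh x|)) := by
    simpa using intervalIntegral.integral_comp_neg (a := -R) (b := 0)
      fun x ↦ Real.cosh x * Real.exp (-(q * |Real.sinh x|))
  calc ∫ x in -R..R, Real.cosh x * Real.exp (-(q * |Real.sinh x|))
      = 2 * ((1 - Real.exp (-(q * Real.sinh R))) / q) := by
        rw [← intervalIntegral.integral_add_adjacent_intervals (hint (-R) 0) (hint 0 R), hneg,
          integral_cosh_mul_exp_eq hq.ne' hR, two_mul]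
    _ ≤ 2 * (1 / q) := by
        gcongr
        exact sub_le_self _ (Real.exp_pos _).le
    _ = 2 / q := mul_one_div _ _

theorem cosh_le_one_add_abs_sinh (x : ℝ) : Real.cosh x ≤ 1 + |Real.sinh x| := by
  refine le_of_sq_le_sq ?_ (by positivity)
  rw [Real.cosh_sq, add_sq, sq_abs]
  linarith [abs_nonneg (Real.sinh x)]

theorem cosh_mul_exp_le {q : ℝ} (hq : 0 < q) (x : ℝ) :
    Real.cosh x * Real.exp (-(q * |Real.sinh x|)) ≤ 1 + 1 / q := by
  rw [Real.exp_neg, ← div_eq_mul_inv, div_le_iff₀ (Real.exp_pos _)]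
  calc Real.cosh x ≤ 1 + |Real.sinh x| := cosh_le_one_add_abs_sinh x
    _ ≤ 1 + |Real.sinh x| + (q * |Real.sinh x| + 1 / q) :=
        le_add_of_nonneg_right (by positivity)
    _ = (1 + 1 / q) * (q * |Real.sinh x| + 1) := by field
    _ ≤ (1 + 1 / q) * Real.exp (q * |Real.sinh x|) := by
        gcongr
        exact Real.add_one_le_exp _

theorem summable_exp_neg_mul_abs {c : ℝ} (hc : 0 < c) :
    Summable fun k : ℤ ↦ Real.exp (-(c * |(k : ℝ)|)) := by
  have hgeom : Summable fun n : ℕ ↦ Real.exp (n * -c) :=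
    Real.summable_exp_nat_mul_iff.mpr (neg_neg_of_pos hc)
  refine .of_nat_of_neg (hgeom.congr fun n ↦ ?_) (hgeom.congr fun n ↦ ?_) <;>
    simp [mul_comm]

theorem summable_cosh_mul_exp {q h : ℝ} (hq : 0 < q) (hh : 0 < h) :
    Summable fun k : ℤ ↦ Real.cosh (k * h) * Real.exp (-(q * |Real.sinh (k * h)|)) := by
  refine .of_nonneg_of_le (fun k ↦ by positivity) (fun k ↦ ?_)
    ((summable_exp_neg_mul_abs (c := q / 2 * h) (by positivity)).mul_left (1 + 1 / (q / 2)))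
  calc Real.cosh (k * h) * Real.exp (-(q * |Real.sinh (k * h)|))
      = Real.cosh (k * h) * Real.exp (-(q / 2 * |Real.sinh (k * h)|)) *
        Real.exp (-(q / 2 * |Real.sinh (k * h)|)) := by
        rw [mul_assoc, ← Real.exp_add]
        ring_nf
    _ ≤ (1 + 1 / (q / 2)) * Real.exp (-(q / 2 * |(k : ℝ) * h|)) := by
        gcongr ?_ * Real.exp (-(_ * ?_))
        · exact cosh_mul_exp_le (half_pos hq) _
        · rw [Real.abs_sinh]
          exact Real.self_le_sinh_iff.mpr (abs_nonneg _)
    _ = _ := by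
        rw [abs_mul, abs_of_pos hh]
        ring_nf

theorem deMap_ofReal (x : ℝ) : deMap x = (Real.exp (π / 2 * Real.sinh x) : ℝ) := by
  simp [deMap]

theorem deriv_deMap_ofReal (x : ℝ) : deriv deMap x =
    (Real.exp (π / 2 * Real.sinh x) * (π / 2 * Real.cosh x) : ℝ) := by
  rw [(hasDerivAt_deMap x).deriv, deMap_ofReal]
  push_cast
  rfl

theorem ofReal_mem_strip {d : ℝ} (hd : 0 < d) (x : ℝ) : (x : ℂ) ∈ strip d := by
  simpa [strip] using hd

theorem ofReal_mem_image_deMap {d : ℝ} (hd : 0 < d) {t : ℝ} (ht : 0 < t) :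
    (t : ℂ) ∈ deMap '' strip d :=
  ⟨deInv t, ofReal_mem_strip hd _, deMap_deInv ht⟩

theorem tendsto_sinh_atBot : Tendsto Real.sinh atBot atBot := by
  refine tendsto_atBot_mono' _ ?_ tendsto_id
  filter_upwards [eventually_le_atBot 0] with x hx
  exact Real.sinh_le_self_iff.mpr hx

theorem norm_E₂_ofReal_le {α β t : ℝ} (hαβ : 0 ≤ α + β) (ht : 0 ≤ t) :
    ‖E₂ t α β‖ ≤ t ^ (α - 1) := by
  have hden : ‖(1 + (t : ℂ) ^ 2)‖ = 1 + t ^ 2 := by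
    rw [← Complex.ofReal_one, ← Complex.ofReal_pow, ← Complex.ofReal_add,
      Complex.norm_of_nonneg (by positivity)]
  rw [E₂, norm_div, Complex.norm_cpow_real, Complex.norm_cpow_real, Complex.norm_of_nonneg ht, hden]
  exact div_le_self (by positivity)
    (Real.one_le_rpow (le_add_of_nonneg_right (sq_nonneg t)) (by positivity))

section RealLine

variable {E : Type*} [NormedAddCommGroup E] [NormedSpace ℂ E] {f : ℂ → E} {d K α β τ : ℝ}

theorem differentiableOn_deIntegrand (hf : AnalyticOnNhd ℂ f (deMap '' strip d)) :
    DifferentiableOn ℂ (deIntegrand f) (strip d) := by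
  have hψ : Differentiable ℂ deMap := fun ζ ↦ (hasDerivAt_deMap ζ).differentiableAt
  exact hψ.deriv.differentiableOn.smul
    (hf.differentiableOn.comp hψ.differentiableOn (Set.mapsTo_image _ _))

theorem continuousOn_comp_ofReal_Ioi (hd : 0 < d) (hf : AnalyticOnNhd ℂ f (deMap '' strip d)) :
    ContinuousOn (fun t : ℝ ↦ f t) (Set.Ioi 0) :=
  hf.continuousOn.comp Complex.continuous_ofReal.continuousOn fun _ ↦ ofReal_mem_image_deMap hd

theorem intervalIntegrable_zero (hd : 0 < d) (hf : AnalyticOnNhd ℂ f (deMap '' strip d))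
    (hK : 0 ≤ K) (hα : 0 < α) (hαβ : 0 ≤ α + β)
    (hbound : ∀ z ∈ deMap '' strip d, ‖f z‖ ≤ K * ‖E₂ z α β‖) (hτ : 0 ≤ τ) :
    IntervalIntegrable (fun t : ℝ ↦ f t) volume 0 τ := by
  have hdom : IntervalIntegrable (fun t : ℝ ↦ K * t ^ (α - 1)) volume 0 τ :=
    (intervalIntegral.intervalIntegrable_rpow' (by linarith)).const_mul K
  refine hdom.mono_fun' ?_ ?_ <;> rw [Set.uIoc_of_le hτ]
  · exact ((continuousOn_comp_ofReal_Ioi hd hf).mono Set.Ioc_subset_Ioi_self).aestronglyMeasurable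
      measurableSet_Ioc
  · filter_upwards [ae_restrict_mem measurableSet_Ioc] with t ht
    refine (hbound _ (ofReal_mem_image_deMap hd ht.1)).trans ?_
    gcongr
    exact norm_E₂_ofReal_le hαβ ht.1.le

theorem integral_deIntegrand_eq (hd : 0 < d) (hf : AnalyticOnNhd ℂ f (deMap '' strip d)) (A B : ℝ) :
    ∫ s : ℝ in A..B, deIntegrand f s =
      ∫ t in Real.exp (π / 2 * Real.sinh A)..Real.exp (π / 2 * Real.sinh B), f t := by
  have hcont : Continuous fun x ↦ Real.exp (π / 2 * Real.sinh x) * (π / 2 * Real.cosh x) := by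
    have := Real.continuous_sinh
    have := Real.continuous_cosh
    fun_prop
  rw [← intervalIntegral.integral_deriv_smul_comp' (g := fun t : ℝ ↦ f t)
    (fun x _ ↦ ((Real.hasDerivAt_sinh x).const_mul (π / 2)).exp) hcont.continuousOn
    ((continuousOn_comp_ofReal_Ioi hd hf).mono ?_)]
  · simp only [deIntegrand, Function.comp_apply, deMap_ofReal, deriv_deMap_ofReal,
      Complex.coe_smul]
  · rintro _ ⟨x, -, rfl⟩
    exact Real.exp_pos _

theorem tendsto_integral_deIntegrand (hd : 0 < d) (hf : AnalyticOnNhd ℂ f (deMap '' strip d))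
    (hτ : 0 < τ) (hint : IntervalIntegrable (fun t : ℝ ↦ f t) volume 0 τ) :
    Tendsto (fun A : ℝ ↦ ∫ s : ℝ in A..deInv τ, deIntegrand f s) atBot
      (𝓝 (∫ t in (0 : ℝ)..τ, f t)) := by
  have hτ' : Real.exp (π / 2 * Real.sinh (deInv τ)) = τ := by
    simpa only [deMap_ofReal, Complex.ofReal_inj] using deMap_deInv hτ
  have hzero : Tendsto (fun A ↦ Real.exp (π / 2 * Real.sinh A)) atBot (𝓝 0) :=
    Real.tendsto_exp_atBot.comp (tendsto_sinh_atBot.const_mul_atBot Real.pi_div_two_pos)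
  have hzero' : Tendsto (fun A ↦ Real.exp (π / 2 * Real.sinh A)) atBot (𝓝[Set.uIcc 0 τ] 0) := by
    refine tendsto_nhdsWithin_iff.mpr ⟨hzero, ?_⟩
    filter_upwards [hzero.eventually_le_const hτ] with A hA
    rw [Set.uIcc_of_le hτ.le]
    exact ⟨(Real.exp_pos _).le, hA⟩
  have hprim : ContinuousOn (fun u ↦ ∫ t in τ..u, f (t : ℝ)) (Set.uIcc 0 τ) :=
    intervalIntegral.continuousOn_primitive_interval' hint Set.right_mem_uIcc
  have hlim := ((hprim 0 Set.left_mem_uIcc).tendsto.comp hzero').neg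
  rw [← intervalIntegral.integral_symm] at hlim
  refine hlim.congr fun A ↦ ?_
  rw [integral_deIntegrand_eq hd hf, hτ', Function.comp_apply, ← intervalIntegral.integral_symm]

theorem summable_norm_deIntegrand (hd : 0 < d) (hK : 0 ≤ K) (hα : 0 < α) (hβ : 0 < β)
    (hbound : ∀ z ∈ deMap '' strip d, ‖f z‖ ≤ K * ‖E₂ z α β‖) {h : ℝ} (hh : 0 < h) :
    Summable fun k : ℤ ↦ ‖deIntegrand f ((k * h : ℝ) : ℂ)‖ := by
  refine .of_nonneg_of_le (fun k ↦ norm_nonneg _) (fun k ↦ ?_)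
    ((summable_cosh_mul_exp (q := π / 2 * min α β) (by positivity) hh).mul_left (K * (π / 2)))
  simpa using norm_deIntegrand_le_of_abs_im_le (e := 0) hK hα.le hβ.le Real.pi_div_two_pos
    (by simp) (hbound _ ⟨_, ofReal_mem_strip hd (k * h), rfl⟩)

theorem integral_norm_deIntegrand_le (hf : AnalyticOnNhd ℂ f (deMap '' strip d)) (hK : 0 ≤ K)
    (hα : 0 < α) (hβ : 0 < β) (hbound : ∀ z ∈ deMap '' strip d, ‖f z‖ ≤ K * ‖E₂ z α β‖)
    {e : ℝ} (hed : e < d) (he : e < π / 2) {y : ℝ} (hy : |y| = e) {R : ℝ} (hR : 0 ≤ R) :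
    ∫ x : ℝ in -R..R, ‖deIntegrand f (x + y * I)‖ ≤
      2 * K / (min α β * Real.cos (π / 2 * Real.sin e) ^ ((α + β) / 2) * Real.cos e) := by
  have he' : |e| < π / 2 := by rwa [← hy, abs_abs, hy]
  have hcos : 0 < Real.cos e := Real.cos_pos_of_mem_Ioo (abs_lt.mp he')
  have hcos' := cos_pi_div_two_mul_sin_pos he'
  set q := π / 2 * min α β * Real.cos e with hq
  have hpt (x : ℝ) : ‖deIntegrand f (x + y * I)‖ ≤
      K * (π / 2) / Real.cos (π / 2 * Real.sin e) ^ ((α + β) / 2) *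
        (Real.cosh x * Real.exp (-(q * |Real.sinh x|))) := by
    simpa using norm_deIntegrand_le_of_abs_im_le (ζ := x + y * I) hK hα.le hβ.le he
      (by simpa using hy.le) (hbound _ ⟨_, by simpa [strip, hy] using hed, rfl⟩)
  calc ∫ x : ℝ in -R..R, ‖deIntegrand f (x + y * I)‖
      ≤ ∫ x in -R..R, K * (π / 2) / Real.cos (π / 2 * Real.sin e) ^ ((α + β) / 2) *
          (Real.cosh x * Real.exp (-(q * |Real.sinh x|))) :=
        intervalIntegral.integral_mono (by linarith)
          ((continuous_comp_horizontal (differentiableOn_deIntegrand hf).continuousOn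
            (hy.trans_lt hed)).norm.intervalIntegrable _ _)
          (((continuous_cosh_mul_exp q).const_mul _).intervalIntegrable _ _) hpt
    _ ≤ K * (π / 2) / Real.cos (π / 2 * Real.sin e) ^ ((α + β) / 2) * (2 / q) := by
        rw [intervalIntegral.integral_const_mul]
        gcongr
        exact integral_cosh_mul_exp_le (by positivity) hR
    _ = _ := by
        rw [hq]
        field

theorem norm_discretization_error_le_of_lt [CompleteSpace E]
    (hf : AnalyticOnNhd ℂ f (deMap '' strip d)) (hK : 0 ≤ K) (hα : 0 < α) (hβ : 0 < β)
    (hbound : ∀ z ∈ deMap '' strip d, ‖f z‖ ≤ K * ‖E₂ z α β‖) {h e : ℝ} (hh : 0 < h)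
    (he : 0 < e) (hed : e < d) (he' : e < π / 2) (hτ : 0 < τ) :
    ‖(∫ t in (0 : ℝ)..τ, f t) - ∑' k : ℤ, J k h (deInv τ) • deIntegrand f ((k * h : ℝ) : ℂ)‖ ≤
      h * (2 * K / (min α β * Real.cos (π / 2 * Real.sin e) ^ ((α + β) / 2) * Real.cos e)) /
        (π * e * Real.sinh (π * e / h)) := by
  have hd : 0 < d := he.trans hed
  have hcos : 0 < Real.cos e := Real.cos_pos_of_mem_Ioo ⟨by linarith, he'⟩
  have hq : 0 < π / 2 * min α β * Real.cos e := by positivity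
  have hcos' := cos_pi_div_two_mul_sin_pos (y := e) (by rwa [abs_of_pos he])
  have hB (z : ℂ) (hz : |z.im| ≤ e) : ‖deIntegrand f z‖ ≤
      K * (π / 2) / Real.cos (π / 2 * Real.sin e) ^ ((α + β) / 2) *
        (1 + 1 / (π / 2 * min α β * Real.cos e)) := by
    refine (norm_deIntegrand_le_of_abs_im_le hK hα.le hβ.le he' hz
      (hbound _ ⟨z, hz.trans_lt hed, rfl⟩)).trans ?_
    gcongr
    exact cosh_mul_exp_le hq _
  exact norm_sub_tsum_J_le hh he hed (differentiableOn_deIntegrand hf) hB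
    (fun R hR y hy ↦ integral_norm_deIntegrand_le hf hK hα hβ hbound hed he' hy hR)
    (summable_norm_deIntegrand hd hK hα hβ hbound hh)
    (tendsto_integral_deIntegrand hd hf hτ
      (intervalIntegrable_zero hd hf hK hα (add_pos hα hβ).le hbound hτ.le))

theorem norm_discretization_error_le [CompleteSpace E]
    (hf : AnalyticOnNhd ℂ f (deMap '' strip d)) (hd : 0 < d) (hd' : d < π / 2) (hK : 0 ≤ K)
    (hα : 0 < α) (hβ : 0 < β)
    (hbound : ∀ z ∈ deMap '' strip d, ‖f z‖ ≤ K * ‖E₂ z α β‖) {h : ℝ} (hh : 0 < h)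
    (hτ : 0 < τ) :
    ‖(∫ t in (0 : ℝ)..τ, f t) - ∑' k : ℤ, J k h (deInv τ) • deIntegrand f ((k * h : ℝ) : ℂ)‖ ≤
      h * (2 * K / (min α β * Real.cos (π / 2 * Real.sin d) ^ ((α + β) / 2) * Real.cos d)) /
        (π * d * Real.sinh (π * d / h)) := by
  have hcos : 0 < Real.cos d := Real.cos_pos_of_mem_Ioo ⟨by linarith, hd'⟩
  have hcos' := cos_pi_div_two_mul_sin_pos (y := d) (by rwa [abs_of_pos hd])
  have hcont : ContinuousAt (fun e ↦
      h * (2 * K / (min α β * Real.cos (π / 2 * Real.sin e) ^ ((α + β) / 2) * Real.cos e)) /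
        (π * e * Real.sinh (π * e / h))) d := by
    have := Real.continuous_sinh
    fun_prop (disch := positivity)
  refine ge_of_tendsto (hcont.tendsto.mono_left (nhdsWithin_le_nhds (s := Set.Iio d))) ?_
  filter_upwards [Ioo_mem_nhdsLT hd] with e he
  exact norm_discretization_error_le_of_lt hf hK hα hβ hbound hh he.1 he.2 (he.2.trans hd') hτ

end RealLine

/-! ### Truncation error -/

theorem cosh_mul_exp_le_two_mul {q x y : ℝ} (hq : 0 < q) (hx : 1 ≤ 2 * q * Real.sinh x)
    (hxy : x ≤ y) : Real.cosh y * Real.exp (-(q * Real.sinh y)) ≤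
      2 * (Real.cosh x * Real.exp (-(q * Real.sinh x))) := by
  have hsinh : 0 < Real.sinh x := pos_of_mul_pos_right (one_pos.trans_le hx) (by positivity)
  have hle : Real.sinh x ≤ Real.sinh y := Real.sinh_le_sinh.mpr hxy
  have hratio : Real.cosh y * Real.sinh x ≤ Real.cosh x * Real.sinh y := by
    have := Real.sinh_nonneg_iff.mpr (sub_nonneg.mpr hxy)
    rw [Real.sinh_sub] at this
    linarith
  have hexp : Real.sinh y ≤ 2 * Real.sinh x * Real.exp (q * (Real.sinh y - Real.sinh x)) :=
    calc Real.sinh y = Real.sinh x + 1 * (Real.sinh y - Real.sinh x) := by ring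
      _ ≤ 2 * Real.sinh x + 2 * q * Real.sinh x * (Real.sinh y - Real.sinh x) := by
          gcongr ?_ + ?_ * _
          · linarith
      _ = 2 * Real.sinh x * (q * (Real.sinh y - Real.sinh x) + 1) := by ring
      _ ≤ _ := by gcongr; exact Real.add_one_le_exp _
  have hmul : Real.cosh y ≤ 2 * Real.cosh x * Real.exp (q * (Real.sinh y - Real.sinh x)) := by
    refine le_of_mul_le_mul_right (hratio.trans ?_) hsinh
    calc Real.cosh x * Real.sinh y
        ≤ Real.cosh x * (2 * Real.sinh x * Real.exp (q * (Real.sinh y - Real.sinh x))) := by gcongr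
      _ = _ := by ring
  calc Real.cosh y * Real.exp (-(q * Real.sinh y))
      ≤ 2 * Real.cosh x * Real.exp (q * (Real.sinh y - Real.sinh x)) *
          Real.exp (-(q * Real.sinh y)) := by gcongr
    _ = _ := by
        rw [mul_assoc, ← Real.exp_add, mul_assoc]
        ring_nf

theorem mul_cosh_mul_exp_le_sub {q h x : ℝ} (hq : 0 < q) (hh : 0 < h)
    (hx : 1 ≤ 2 * q * Real.sinh x) :
    h * (Real.cosh (x + h) * Real.exp (-(q * Real.sinh (x + h)))) ≤
      2 / q * (Real.exp (-(q * Real.sinh x)) - Real.exp (-(q * Real.sinh (x + h)))) := by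
  obtain ⟨ξ, ⟨hxξ, hξ⟩, hslope⟩ := exists_hasDerivAt_eq_slope
    (fun x ↦ -(Real.exp (-(q * Real.sinh x)) / q)) _ (lt_add_of_pos_right x hh)
    (fun y _ ↦ (hasDerivAt_exp_neg_mul_sinh hq.ne' y).continuousAt.continuousWithinAt)
    (fun y _ ↦ hasDerivAt_exp_neg_mul_sinh hq.ne' y)
  have hx' : 1 ≤ 2 * q * Real.sinh ξ := hx.trans (by gcongr; exact Real.sinh_le_sinh.mpr hxξ.le)
  calc h * (Real.cosh (x + h) * Real.exp (-(q * Real.sinh (x + h))))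
      ≤ h * (2 * (Real.cosh ξ * Real.exp (-(q * Real.sinh ξ)))) := by
        gcongr h * ?_
        exact cosh_mul_exp_le_two_mul hq hx' hξ.le
    _ = _ := by
        rw [hslope, add_sub_cancel_left]
        field

theorem sum_Ioc_le_sub {a g : ℤ → ℝ} {N N' : ℤ} (hN : N ≤ N')
    (ha : ∀ k, N ≤ k → a (k + 1) ≤ g k - g (k + 1)) :
    ∑ k ∈ Finset.Ioc N N', a k ≤ g N - g N' := by
  induction N', hN using Int.leInduction with
  | base => simp
  | succ k hk ih =>
    rw [← Finset.insert_Ioc_right_eq_Ioc_add_one hk,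
      Finset.sum_insert (by simp [Finset.mem_Ioc])]
    linarith [ha k hk]

theorem sum_mul_cosh_mul_exp_le {q h : ℝ} (hq : 0 < q) (hh : 0 < h) {N : ℤ}
    (hN : 1 ≤ 2 * q * Real.sinh (N * h)) (N' : ℤ) :
    ∑ k ∈ Finset.Ioc N N', h * (Real.cosh (k * h) * Real.exp (-(q * Real.sinh (k * h)))) ≤
      2 / q * Real.exp (-(q * Real.sinh (N * h))) := by
  rcases lt_or_ge N' N with hlt | hge
  · rw [Finset.Ioc_eq_empty_of_le hlt.le, Finset.sum_empty]
    positivity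
  refine (sum_Ioc_le_sub (g := fun k : ℤ ↦ 2 / q * Real.exp (-(q * Real.sinh (k * h)))) hge
    fun k hk ↦ ?_).trans (sub_le_self _ (by positivity))
  have hk' : 1 ≤ 2 * q * Real.sinh (k * h) := hN.trans (by
    gcongr
    exact Real.sinh_le_sinh.mpr (by gcongr))
  rw [← mul_sub, Int.cast_add, Int.cast_one, add_one_mul]
  exact mul_cosh_mul_exp_le_sub hq hh hk'

theorem norm_tsum_sub_sum_Icc_le {G : Type*} [NormedAddCommGroup G] {u : ℤ → G}
    (hu : Summable u) {M N : ℤ} {a b : ℝ} (hN : ∀ n, ∑ k ∈ Finset.Ioc N n, ‖u k‖ ≤ a)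
    (hM : ∀ n, ∑ k ∈ Finset.Ioc M n, ‖u (-k)‖ ≤ b) :
    ‖∑' k, u k - ∑ k ∈ Finset.Icc (-M) N, u k‖ ≤ a + b := by
  refine le_of_tendsto ((hu.hasSum.comp (Finset.tendsto_Icc_neg (R := ℤ))).sub_const _).norm ?_
  filter_upwards [eventually_ge_atTop (max M.natAbs N.natAbs)] with n hn
  have hMn : M ≤ n := by lia
  have hNn : N ≤ n := by lia
  have hsub : Finset.Icc (-(n : ℤ)) n \ Finset.Icc (-M) N ⊆
      Finset.Ioc N n ∪ Finset.Ico (-(n : ℤ)) (-M) := by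
    intro k
    simp only [Finset.mem_sdiff, Finset.mem_Icc, Finset.mem_union, Finset.mem_Ioc, Finset.mem_Ico]
    lia
  have hneg : ∑ k ∈ Finset.Ico (-(n : ℤ)) (-M), ‖u k‖ = ∑ k ∈ Finset.Ioc M n, ‖u (-k)‖ :=
    Finset.sum_nbij' (- ·) (- ·) (by simp; lia) (by simp; lia) (by simp) (by simp) (by simp)
  rw [Function.comp_apply, ← Finset.sum_sdiff (Finset.Icc_subset_Icc (neg_le_neg hMn) hNn),
    add_sub_cancel_right]
  calc ‖∑ k ∈ Finset.Icc (-(n : ℤ)) n \ Finset.Icc (-M) N, u k‖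
      ≤ ∑ k ∈ Finset.Ioc N n ∪ Finset.Ico (-(n : ℤ)) (-M), ‖u k‖ :=
        (norm_sum_le _ _).trans
          (Finset.sum_le_sum_of_subset_of_nonneg hsub fun _ _ _ ↦ norm_nonneg _)
    _ ≤ ∑ k ∈ Finset.Ioc N n, ‖u k‖ + ∑ k ∈ Finset.Ico (-(n : ℤ)) (-M), ‖u k‖ := by
        rw [← Finset.sum_union_inter]
        exact le_add_of_nonneg_right (Finset.sum_nonneg fun _ _ ↦ norm_nonneg _)
    _ ≤ a + b := add_le_add (hN n) (hneg.trans_le (hM n))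

section Truncation

variable {E : Type*} [NormedAddCommGroup E] [NormedSpace ℂ E] {f : ℂ → E} {K α β : ℝ}

theorem norm_deIntegrand_ofReal_le (hK : 0 ≤ K) (hαβ : 0 ≤ α + β) {x : ℝ}
    (hf : ‖f (deMap x)‖ ≤ K * ‖E₂ (deMap x) α β‖) :
    ‖deIntegrand f x‖ ≤
      K * (π / 2) * (Real.cosh x * Real.exp (-(π / 2 * β * Real.sinh x))) := by
  have hle := norm_deIntegrand_le hK hαβ (by simpa using Real.pi_div_two_pos) hf
  simp only [Complex.ofReal_im, Real.sin_zero, mul_zero, Real.cos_zero, Real.one_rpow, div_one,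
    Complex.ofReal_re] at hle
  refine hle.trans ?_
  gcongr
  refine (min_le_right _ _).trans_eq ?_
  rw [norm_deMap, ← Real.exp_mul]
  simp only [Complex.ofReal_im, Complex.ofReal_re, Real.cos_zero]
  ring_nf

theorem norm_deIntegrand_ofReal_neg_le (hK : 0 ≤ K) (hαβ : 0 ≤ α + β) {x : ℝ}
    (hf : ‖f (deMap (-x : ℝ))‖ ≤ K * ‖E₂ (deMap (-x : ℝ)) α β‖) :
    ‖deIntegrand f (-x : ℝ)‖ ≤
      K * (π / 2) * (Real.cosh x * Real.exp (-(π / 2 * α * Real.sinh x))) := by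
  have hle := norm_deIntegrand_le hK hαβ (by simpa using Real.pi_div_two_pos) hf
  simp only [Complex.ofReal_im, Real.sin_zero, mul_zero, Real.cos_zero, Real.one_rpow, div_one,
    Complex.ofReal_re, Real.cosh_neg] at hle
  refine hle.trans ?_
  gcongr
  refine (min_le_left _ _).trans_eq ?_
  rw [norm_deMap, ← Real.exp_mul]
  simp only [Complex.ofReal_im, Complex.ofReal_re, Real.cos_zero, Real.sinh_neg]
  ring_nf

theorem sum_norm_smul_le {c : ℤ → ℝ} {v : ℤ → E} {C q h : ℝ} (hC : 0 ≤ C) (hq : 0 < q) (hh : 0 < h)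
    (hc : ∀ k, |c k| ≤ 3 / 2 * h)
    (hv : ∀ k : ℤ, ‖v k‖ ≤ C * (Real.cosh (k * h) * Real.exp (-(q * Real.sinh (k * h)))))
    {N : ℤ} (hN : 1 ≤ 2 * q * Real.sinh (N * h)) (N' : ℤ) :
    ∑ k ∈ Finset.Ioc N N', ‖c k • v k‖ ≤ 3 * C / q * Real.exp (-(q * Real.sinh (N * h))) := by
  calc ∑ k ∈ Finset.Ioc N N', ‖c k • v k‖
      ≤ ∑ k ∈ Finset.Ioc N N', 3 / 2 * h *
          (C * (Real.cosh (k * h) * Real.exp (-(q * Real.sinh (k * h))))) := by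
        gcongr with k
        rw [norm_smul, Real.norm_eq_abs]
        gcongr
        exacts [hc k, hv k]
    _ = 3 / 2 * C * ∑ k ∈ Finset.Ioc N N',
          h * (Real.cosh (k * h) * Real.exp (-(q * Real.sinh (k * h)))) := by
        rw [Finset.mul_sum]
        exact Finset.sum_congr rfl fun k _ ↦ by ring
    _ ≤ 3 / 2 * C * (2 / q * Real.exp (-(q * Real.sinh (N * h)))) := by
        gcongr
        exact sum_mul_cosh_mul_exp_le hq hh hN N'
    _ = _ := by field

theorem norm_truncation_error_le [CompleteSpace E] {d h : ℝ} (hd : 0 < d) (hK : 0 ≤ K) (hα : 0 < α)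
    (hβ : 0 < β) (hbound : ∀ z ∈ deMap '' strip d, ‖f z‖ ≤ K * ‖E₂ z α β‖) (hh : 0 < h) {M N : ℤ}
    (hM : 1 ≤ π * α * Real.sinh (M * h)) (hN : 1 ≤ π * β * Real.sinh (N * h)) (x : ℝ) :
    ‖∑' k : ℤ, J k h x • deIntegrand f ((k * h : ℝ) : ℂ) -
        ∑ k ∈ Finset.Icc (-M) N, J k h x • deIntegrand f ((k * h : ℝ) : ℂ)‖ ≤
      3 * K / β * Real.exp (-(π / 2 * β * Real.sinh (N * h))) +
        3 * K / α * Real.exp (-(π / 2 * α * Real.sinh (M * h))) := by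
  have hbound' (y : ℝ) : ‖f (deMap y)‖ ≤ K * ‖E₂ (deMap y) α β‖ :=
    hbound _ ⟨y, ofReal_mem_strip hd y, rfl⟩
  have hJ (k : ℤ) : |J k h x| ≤ 3 / 2 * h := abs_J_le k hh.le x
  have hsum : Summable fun k : ℤ ↦ J k h x • deIntegrand f ((k * h : ℝ) : ℂ) := by
    refine .of_norm_bounded ((summable_norm_deIntegrand hd hK hα hβ hbound hh).mul_left (3 / 2 * h))
      fun k ↦ ?_
    rw [norm_smul, Real.norm_eq_abs]
    gcongr
    exact hJ k
  have hC {γ : ℝ} (hγ : 0 < γ) : 3 * (K * (π / 2)) / (π / 2 * γ) = 3 * K / γ := by field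
  rw [← hC hα, ← hC hβ]
  refine norm_tsum_sub_sum_Icc_le hsum (sum_norm_smul_le (by positivity) (by positivity) hh hJ
    (fun k ↦ norm_deIntegrand_ofReal_le hK (by positivity) (hbound' _)) (by linarith))
    (sum_norm_smul_le (by positivity) (by positivity) hh (fun k ↦ hJ (-k)) (fun k ↦ ?_)
      (by linarith))
  rw [Int.cast_neg, neg_mul]
  exact norm_deIntegrand_ofReal_neg_le hK (by positivity) (hbound' _)

end Truncation

/-! ### Explicit constants -/

theorem one_le_mul_sinh_of_xThreshold_le {γ x : ℝ} (hγ : 0 < γ) (hx : xThreshold (γ / 2) ≤ x) :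
    1 ≤ π * γ * Real.sinh x := by
  have hc : 0 < π * γ := by positivity
  rw [xThreshold, show 2 * π * (γ / 2) = π * γ by ring] at hx
  refine le_trans ?_ (mul_le_mul_of_nonneg_left (Real.sinh_le_sinh.mpr hx) hc.le)
  split_ifs with hlt
  · rw [Real.sinh_arsinh, mul_div_cancel₀ _ hc.ne', Real.one_le_sqrt]
    exact le_add_of_nonneg_right (Real.sqrt_nonneg _)
  · rw [Real.sinh_arsinh, mul_one]
    rw [not_lt, div_le_iff₀ (by positivity)] at hlt
    linarith

theorem log_mul_exp_one_le {m : ℝ} (hm : 0 < m) : Real.log m * Real.exp 1 ≤ m := by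
  simpa only [Real.exp_log hm, mul_comm] using Real.exp_one_mul_le_exp (x := Real.log m)

theorem one_le_exp_one_mul {L : ℝ} (hL : 1 ≤ L) :
    1 ≤ Real.exp 1 * (L - 1 + L * Real.exp (-L)) := by
  have he : 2 < Real.exp 1 := Real.exp_one_gt_two
  have hexp : 2 - L ≤ Real.exp 1 * Real.exp (-L) := by
    rw [← Real.exp_add]
    linarith [Real.add_one_le_exp (1 + -L)]
  rcases le_total L 2 with hL2 | hL2
  · calc 1 ≤ 2 * (L - 1) + L * (2 - L) := by nlinarith
      _ ≤ Real.exp 1 * (L - 1) + L * (Real.exp 1 * Real.exp (-L)) := by gcongr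
      _ = _ := by ring
  · calc 1 ≤ Real.exp 1 * 1 := by linarith
      _ ≤ _ := by
        gcongr
        have : 0 ≤ L * Real.exp (-L) := by positivity
        linarith

theorem three_mul_mul_exp_neg_le {μ q L : ℝ} (hq : 0 ≤ q) (hL : 1 ≤ L)
    (hμ : 4 * q = μ * Real.exp L) :
    3 * q * Real.exp (-(π * q)) ≤ Real.exp (π * μ / 4) * (Real.exp (-(π * q / L)) * L) := by
  have hμq : μ = 4 * q * Real.exp (-L) := by rw [hμ, mul_assoc, ← Real.exp_add]; simp
  have key : 3 * q ≤ L * Real.exp (π * q - π * q / L + π * μ / 4) := by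
    calc 3 * q ≤ π * q * 1 := by rw [mul_one]; gcongr; exact Real.pi_gt_three.le
      _ ≤ π * q * (Real.exp 1 * (L - 1 + L * Real.exp (-L))) := by
          gcongr
          exact one_le_exp_one_mul hL
      _ = L * (Real.exp 1 * (π * q - π * q / L + π * μ / 4)) := by rw [hμq]; field
      _ ≤ _ := by gcongr; exact Real.exp_one_mul_le_exp
  calc 3 * q * Real.exp (-(π * q))
      ≤ L * Real.exp (π * q - π * q / L + π * μ / 4) * Real.exp (-(π * q)) := by gcongr
    _ = _ := by
        rw [mul_comm _ L, mul_left_comm, mul_assoc, ← Real.exp_add, ← Real.exp_add]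
        ring_nf

theorem exp_neg_mul_sinh_le {γ x y : ℝ} (hγ : 0 < γ) (hx : 0 ≤ x)
    (hxy : 4 * y / γ ≤ Real.exp x) :
    Real.exp (-(π / 2 * γ * Real.sinh x)) ≤ Real.exp (π * γ / 4) * Real.exp (-(π * y)) := by
  rw [← Real.exp_add, Real.exp_le_exp]
  have hexp : Real.exp (-x) ≤ 1 := Real.exp_le_one_iff.mpr (by linarith)
  have hsinh : 4 * y / γ - 1 ≤ 2 * Real.sinh x := by
    rw [Real.sinh_eq]
    linarith
  calc -(π / 2 * γ * Real.sinh x) = -(π / 4 * γ * (2 * Real.sinh x)) := by ring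
    _ ≤ -(π / 4 * γ * (4 * y / γ - 1)) := by gcongr
    _ = _ := by field

theorem div_le_exp_sub_floor_mul {h m r : ℝ} (hh : 0 < h) (hm : 0 < m) (hr : 0 < r) {n : ℕ}
    (hnh : n * h = Real.log m) :
    m / r ≤ Real.exp ((n - ⌊Real.log r / h⌋ : ℤ) * h) := by
  rw [← Real.exp_log hm, ← Real.exp_log hr, ← Real.exp_sub, Real.exp_le_exp, Real.exp_log hr]
  have hfloor := (le_div_iff₀ hh).mp (Int.floor_le (Real.log r / h))
  push_cast
  linarith

theorem truncN_eq_truncM (α β h : ℝ) (n : ℕ) : truncN α β h n = truncM β α h n := by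
  rw [truncN, truncM]
  rcases lt_trichotomy α β with hlt | rfl | hgt
  · rw [if_pos hlt.le, if_neg hlt.not_ge]
  · by_cases hα : α = 0 <;> simp [hα]
  · rw [if_neg hgt.not_ge, if_pos hgt.le]

theorem exp_one_le_div_min_of_max_mul_div_le {α β d : ℝ} (hα : 0 < α) (hβ : 0 < β) (hd : 0 < d)
    {n : ℕ} (hn : max α β * Real.exp 1 / (4 * d) ≤ n) :
    Real.exp 1 ≤ 4 * d * n / min α β := by
  rw [le_div_iff₀ (lt_min hα hβ), mul_comm, mul_comm (4 * d), ← div_le_iff₀ (by positivity)]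
  refine le_trans ?_ hn
  gcongr
  exact min_le_max

theorem one_le_log_of_exp_one_le {m : ℝ} (hm : Real.exp 1 ≤ m) : 1 ≤ Real.log m :=
  (Real.le_log_iff_exp_le ((Real.exp_pos 1).trans_le hm)).mpr hm

theorem natCast_pos_of_exp_one_le {a b : ℝ} {n : ℕ} (hn : Real.exp 1 ≤ a * n / b) :
    (0 : ℝ) < n := by
  rcases n.eq_zero_or_pos with rfl | hpos
  · simp only [CharP.cast_eq_zero, mul_zero, zero_div] at hn
    exact absurd hn (Real.exp_pos 1).not_ge
  · exact_mod_cast hpos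

theorem le_exp_truncM_mul {α β d h : ℝ} (hα : 0 < α) (hβ : 0 < β) {n : ℕ}
    (hn : Real.exp 1 ≤ 4 * d * n / min α β)
    (hh : h = Real.log (4 * d * n / min α β) / n) :
    4 * d * n / α ≤ Real.exp (truncM α β h n * h) := by
  have hn0 : (0 : ℝ) < n := natCast_pos_of_exp_one_le hn
  have hm : 0 < 4 * d * n / min α β := (Real.exp_pos 1).trans_le hn
  have hnh : n * h = Real.log (4 * d * n / min α β) := by rw [hh]; field
  rw [truncM]
  split_ifs with hαβ
  · rw [Int.cast_natCast, hnh, Real.exp_log hm, min_eq_left hαβ]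
  · have hh0 : 0 < h := by rw [hh]; exact div_pos (by linarith [one_le_log_of_exp_one_le hn]) hn0
    refine le_trans (le_of_eq ?_) (div_le_exp_sub_floor_mul hh0 hm (div_pos hα hβ) hnh)
    rw [min_eq_right (not_le.mp hαβ).le]
    field

theorem truncation_tail_le {K γ μ ν d x : ℝ} (hK : 0 ≤ K) (hμ : 0 < μ) (hμγ : μ ≤ γ)
    (hγν : γ ≤ ν) (hd : 0 < d) {n : ℕ} (hn : Real.exp 1 ≤ 4 * d * n / μ) (hx : 0 ≤ x)
    (hexp : 4 * d * n / γ ≤ Real.exp x) :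
    3 * K / γ * Real.exp (-(π / 2 * γ * Real.sinh x)) ≤
      K / (μ * d) * Real.exp (π * (μ + ν) / 4) * epsDE d μ n := by
  have hn0 : (0 : ℝ) < n := natCast_pos_of_exp_one_le hn
  have hγ : 0 < γ := hμ.trans_le hμγ
  have hlog : 4 * (d * n) = μ * Real.exp (Real.log (4 * d * n / μ)) := by
    rw [Real.exp_log (by positivity)]
    field
  calc 3 * K / γ * Real.exp (-(π / 2 * γ * Real.sinh x))
      ≤ 3 * K / μ * (Real.exp (π * ν / 4) * Real.exp (-(π * (d * n)))) := by
        gcongr ?_ * ?_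
        · gcongr
        · refine (exp_neg_mul_sinh_le hγ hx (by rwa [← mul_assoc])).trans ?_
          gcongr
    _ = K / (μ * d * n) * Real.exp (π * ν / 4) *
          (3 * (d * n) * Real.exp (-(π * (d * n)))) := by field
    _ ≤ K / (μ * d * n) * Real.exp (π * ν / 4) * (Real.exp (π * μ / 4) *
          (Real.exp (-(π * (d * n) / Real.log (4 * d * n / μ))) *
            Real.log (4 * d * n / μ))) := by
        gcongr _ * ?_
        exact three_mul_mul_exp_neg_le (by positivity) (one_le_log_of_exp_one_le hn) hlog
    _ = _ := by
        rw [epsDE, mul_add, add_div, Real.exp_add, ← mul_assoc π]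
        field

theorem exp_mul_one_sub_div_two_le_sinh {t E : ℝ} (hE : Real.exp (-(2 * t)) ≤ E) :
    Real.exp t * (1 - E) / 2 ≤ Real.sinh t := by
  have hneg : Real.exp (-t) = Real.exp t * Real.exp (-(2 * t)) := by
    rw [← Real.exp_add]
    ring_nf
  calc Real.exp t * (1 - E) / 2 ≤ Real.exp t * (1 - Real.exp (-(2 * t))) / 2 := by gcongr
    _ = Real.sinh t := by
        rw [Real.sinh_eq, hneg]
        ring

theorem mul_div_mul_sinh_le {A μ d h : ℝ} (hA : 0 ≤ A) (hμ : 0 < μ) (hd : 0 < d) {n : ℕ}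
    (hn : Real.exp 1 ≤ 4 * d * n / μ) (hh : h = Real.log (4 * d * n / μ) / n) :
    h * A / (π * d * Real.sinh (π * d / h)) ≤
      A / d / (1 - Real.exp (-(π * μ * Real.exp 1 / 2))) * epsDE d μ n := by
  have hn0 : (0 : ℝ) < n := natCast_pos_of_exp_one_le hn
  have hlog : 0 < Real.log (4 * d * n / μ) := one_pos.trans_le (one_le_log_of_exp_one_le hn)
  have hh0 : 0 < h := by rw [hh]; positivity
  have hE : 0 < 1 - Real.exp (-(π * μ * Real.exp 1 / 2)) := by
    rw [sub_pos, Real.exp_lt_one_iff, neg_lt_zero]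
    positivity
  have hhμ : h * (μ * Real.exp 1) ≤ 4 * d := by
    calc h * (μ * Real.exp 1) = μ / n * (Real.log (4 * d * n / μ) * Real.exp 1) := by rw [hh]; ring
      _ ≤ μ / n * (4 * d * n / μ) := by gcongr; exact log_mul_exp_one_le (by positivity)
      _ = 4 * d := by field
  have hexp : π * μ * Real.exp 1 / 2 ≤ 2 * (π * d / h) := by
    rw [← mul_div_assoc, le_div_iff₀ hh0]
    calc π * μ * Real.exp 1 / 2 * h = π / 2 * (h * (μ * Real.exp 1)) := by ring
      _ ≤ π / 2 * (4 * d) := by gcongr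
      _ = _ := by ring
  have hsinh := exp_mul_one_sub_div_two_le_sinh (Real.exp_le_exp.mpr (neg_le_neg hexp))
  calc h * A / (π * d * Real.sinh (π * d / h))
      ≤ h * A / (2 * d * (Real.exp (π * d / h) *
          (1 - Real.exp (-(π * μ * Real.exp 1 / 2))) / 2)) := by
        gcongr
        exact Real.two_le_pi
    _ = A / d / (1 - Real.exp (-(π * μ * Real.exp 1 / 2))) * (Real.exp (-(π * d / h)) * h) := by
        rw [Real.exp_neg (π * d / h)]
        field
    _ = _ := by
        rw [epsDE, mul_div_assoc (Real.exp _), hh, div_div_eq_mul_div]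

end SincDE

open SincDE MeasureTheory in
open scoped Real in
theorem theorem3p5_general {E : Type*} [NormedAddCommGroup E] [NormedSpace ℂ E] [CompleteSpace E]
    {f : ℂ → E} {K α β d h τ : ℝ} (hd : 0 < d) (hd' : d < π / 2)
    (hf : AnalyticOnNhd ℂ f (deMap '' strip d)) (hK : 0 ≤ K) (hα : 0 < α) (hβ : 0 < β)
    (hbound : ∀ z ∈ deMap '' strip d, ‖f z‖ ≤ K * ‖E₂ z α β‖) {n : ℕ}
    (hn : Real.exp 1 ≤ 4 * d * n / min α β) (hh : h = Real.log (4 * d * n / min α β) / n)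
    {M N : ℤ} (hM : 4 * d * n / α ≤ Real.exp (M * h)) (hN : 4 * d * n / β ≤ Real.exp (N * h))
    (hMh : 1 ≤ π * α * Real.sinh (M * h)) (hNh : 1 ≤ π * β * Real.sinh (N * h))
    (hτ : 0 < τ) :
    IntervalIntegrable (fun t : ℝ ↦ f t) volume 0 τ ∧
      ‖(∫ t in (0 : ℝ)..τ, f t) - ∑ k ∈ Finset.Icc (-M) N,
          J k h (deInv τ) • deriv deMap ((k * h : ℝ) : ℂ) • f (deMap ((k * h : ℝ) : ℂ))‖ ≤
        constC₂ K α β d (min α β) * epsDE d (min α β) n := by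
  refine ⟨intervalIntegrable_zero hd hf hK hα (by positivity) hbound hτ.le, ?_⟩
  have hμ : 0 < min α β := lt_min hα hβ
  have hh0 : 0 < h := by
    rw [hh]
    exact div_pos (one_pos.trans_le (one_le_log_of_exp_one_le hn)) (natCast_pos_of_exp_one_le hn)
  have hpos {γ x : ℝ} (hγ : 0 < γ) (hx : 1 ≤ π * γ * Real.sinh x) : 0 ≤ x :=
    Real.sinh_nonneg_iff.mp
      (pos_of_mul_pos_right (one_pos.trans_le hx) (by positivity)).le
  have hcos : 0 < Real.cos (π / 2 * Real.sin d) :=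
    cos_pi_div_two_mul_sin_pos (by rwa [abs_of_pos hd])
  have hcos' : 0 < Real.cos d := Real.cos_pos_of_mem_Ioo ⟨by linarith, hd'⟩
  have hdisc := (norm_discretization_error_le hf hd hd' hK hα hβ hbound hh0 hτ).trans
    (mul_div_mul_sinh_le (by positivity) hμ hd hn hh)
  have htrunc := (norm_truncation_error_le hd hK hα hβ hbound hh0 hMh hNh (deInv τ)).trans
    (add_le_add
      (truncation_tail_le hK hμ (min_le_right _ _) (le_max_right α β) hd hn (hpos hβ hNh) hN)
      (truncation_tail_le hK hμ (min_le_left _ _) (le_max_left α β) hd hn (hpos hα hMh) hM))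
  rw [min_add_max] at htrunc
  refine (norm_sub_le_norm_sub_add_norm_sub _ _ _).trans
    ((add_le_add hdisc htrunc).trans_eq ?_)
  rw [constC₂, mul_assoc (1 - _), one_div, mul_inv]
  ring

theorem theorem3p5
    (d : ℝ) (hd : 0 < d) (hd' : d < Real.pi / 2)
    (f : ℂ → ℂ) (hf : AnalyticOnNhd ℂ f (SincDE.deMap '' SincDE.strip d))
    (K α β : ℝ) (hK : 0 < K) (hα : 0 < α) (hβ : 0 < β)
    (hbound : ∀ z ∈ SincDE.deMap '' SincDE.strip d, ‖f z‖ ≤ K * ‖SincDE.E₂ z α β‖)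
    (μ ν : ℝ) (hμ : μ = min α β) (hν : ν = max α β)
    (n : ℕ) (h : ℝ) (hh : h = Real.log (4 * d * n / μ) / n)
    (M N : ℤ) (hM : M = SincDE.truncM α β h n) (hN : N = SincDE.truncN α β h n)
    (hn : ν * Real.exp 1 / (4 * d) ≤ n)
    (hMh : SincDE.xThreshold (α / 2) ≤ M * h)
    (hNh : SincDE.xThreshold (β / 2) ≤ N * h) :
    ∀ τ : ℝ, 0 < τ →
      IntervalIntegrable (fun t : ℝ => f t) MeasureTheory.volume 0 τ ∧
      ‖(∫ t in (0 : ℝ)..τ, f t) -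
          ∑ k ∈ Finset.Icc (-M) N,
            f (SincDE.deMap ((k * h : ℝ) : ℂ)) * deriv SincDE.deMap ((k * h : ℝ) : ℂ) *
              (SincDE.J k h (SincDE.deInv τ) : ℂ)‖
        ≤ SincDE.constC₂ K α β d μ * SincDE.epsDE d μ n := by
  intro τ hτ
  subst hμ hν hM
  rw [SincDE.truncN_eq_truncM] at hN
  subst hN
  have hn' := SincDE.exp_one_le_div_min_of_max_mul_div_le hα hβ hd hn
  simpa only [Complex.real_smul, smul_eq_mul, mul_comm, mul_left_comm] using
    theorem3p5_general hd hd' hf hK.le hα hβ hbound hn' hh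
      (SincDE.le_exp_truncM_mul hα hβ hn' hh)
      (SincDE.le_exp_truncM_mul hβ hα (by rwa [min_comm]) (by rwa [min_comm]))
      (SincDE.one_le_mul_sinh_of_xThreshold_le hα hMh)
      (SincDE.one_le_mul_sinh_of_xThreshold_le hβ hNh) hτ
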